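/- Let $p\ge 1$, and let $B(p,p)$ be the toric braid word $(\sigma_1\sigma_2\cdots\sigma_{p-1})^p$ on $p$ strands, where $\sigma_1,\dots,\sigma_{p-1}$ are the elementary braids. Number its crossings $1,2,\dots,p(p-1)$ from first to last, and let the torus link $K(p,p)\subset\mathbb R^3$ be the closure of $B(p,p)$. The U-crossing data $U(B(p,p))$ is the set of the numbers $k(p-1)-j$ with $1\le k\le p$ and $0\le j\le k-2$; that is, it takes the last $k-1$ crossings of the $k$-th factor $\sigma_1\sigma_2\cdots\sigma_{p-1}$, for $k=1,\dots,p$. The unknotting number of a link $K$ is the minimal number of crossings that have to be switched at once in a diagram to obtain a diagram of an unlink (of an unknot, if $K$ has one component), the minimum being taken over all diagrams of links isotopic to $K$. Then switching the crossings of $B(p,p)$ whose numbers lie in $U(B(p,p))$ gives a braid word whose closure is an unlink. Moreover $$|U(B(p,p))|=\frac{p(p-1)}{2},$$ and this number is the unknotting number of $K(p,p)$. Hence $U(B(p,p))$ is a minimal unknotting crossing data for $B(p,p)$ and for $K(p,p)$, that is, a set of crossings of $B(p,p)$ whose switching makes the closure an unlink and whose number of elements is the unknotting number of the closure. -/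

import Mathlib

/-!
Links are smooth embeddings of finitely many circles in `ℝ³`, and two links are equivalent when they
are smoothly isotopic.  Throughout, `ℝ³` is `ℂ × ℝ`: diagrams are drawn in the plane `ℂ`, so the
first component is the projection to the diagram, and the second one is the height, with larger
heights lying over smaller ones.
-/

namespace TorusLinks

open scoped ContDiff

noncomputable section

/-- A family of parametrized curves in `ℝ³ = ℂ × ℝ`, meant to be closed of period `1`. -/
abbrev Curves (ι : Type) : Type := ι → ℝ → ℂ × ℝ

/-- `(i, s)` and `(j, t)` are the same point of the disjoint union of the circles `ℝ / ℤ`,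
one for each index. -/
def SamePoint {ι : Type} (i : ι) (s : ℝ) (j : ι) (t : ℝ) : Prop :=
  i = j ∧ ∃ k : ℤ, t = s + k

/-- The curves form a link: together they are a smooth embedding of a disjoint union of circles
`ℝ / ℤ` in `ℝ³`. -/
structure IsLink {ι : Type} (L : Curves ι) : Prop where
  smooth : ∀ i, ContDiff ℝ ∞ (L i)
  periodic : ∀ i s, L i (s + 1) = L i s
  immersion : ∀ i s, deriv (L i) s ≠ 0
  injective : ∀ i s j t, L i s = L j t → SamePoint i s j t

/-- Smooth isotopy of links: a smooth one-parameter family of links from `L` to `L'`. -/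
def Isotopic {ι : Type} (L L' : Curves ι) : Prop :=
  ∃ F : ℝ → Curves ι,
    (∀ i, ContDiff ℝ ∞ (fun q : ℝ × ℝ => F q.1 i q.2)) ∧
    (∀ τ ∈ Set.Icc (0 : ℝ) 1, IsLink (F τ)) ∧ F 0 = L ∧ F 1 = L'

/-- The unit circles with centres `3 * c i` in the plane of height `0`. -/
def roundCircles {ι : Type} (c : ι → ℕ) : Curves ι :=
  fun i s => (3 * (c i : ℂ) + Complex.exp (2 * Real.pi * Complex.I * s), 0)

/-- `L` is an unlink (an unknot, if there is one component): it is isotopic to a family of disjoint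
round circles in a plane, none of which encloses another one. -/
def IsUnlink {ι : Type} (L : Curves ι) : Prop :=
  ∃ c : ι → ℕ, Function.Injective c ∧ Isotopic L (roundCircles c)

/-- The projection of `L` to the plane is a link diagram: the projected curves are immersed,
their multiple points are transverse, and there are no triple points. -/
structure IsDiagram {ι : Type} (L : Curves ι) : Prop where
  immersion : ∀ i s, deriv (fun u => (L i u).1) s ≠ 0
  transverse : ∀ i s j t, (L i s).1 = (L j t).1 → ¬ SamePoint i s j t →
    LinearIndependent ℝ ![deriv (fun u => (L i u).1) s, deriv (fun u => (L j u).1) t]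
  no_triple : ∀ i s j t k u, (L i s).1 = (L j t).1 → (L j t).1 = (L k u).1 →
    SamePoint i s j t ∨ SamePoint j t k u ∨ SamePoint i s k u

/-- For two links with the same projection: the crossings (as points of the plane) at which the
overcrossing strand of `L` is the undercrossing strand of `L'`. -/
def switchedCrossings {ι : Type} (L L' : Curves ι) : Set ℂ :=
  {z | ∃ i s j t, (L i s).1 = z ∧ (L j t).1 = z ∧
    (L i s).2 < (L j t).2 ∧ (L' j t).2 < (L' i s).2}

/-- Some diagram of the link `K` becomes a diagram of an unlink when exactly `k` of its crossings
are switched. -/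
def CanBeUnlinkedBy {ι : Type} (K : Curves ι) (k : ℕ) : Prop :=
  ∃ L L' : Curves ι, Isotopic K L ∧ IsDiagram L ∧
    (∀ i s, (L' i s).1 = (L i s).1) ∧ (switchedCrossings L L').encard = k ∧ IsUnlink L'

/-- `u` is the unknotting number of `K`: the minimal number of crossing switches that turn some
diagram of `K` into a diagram of an unlink. -/
def IsUnknottingNumber {ι : Type} (K : Curves ι) (u : ℕ) : Prop :=
  IsLeast {k : ℕ | CanBeUnlinkedBy K k} u

/-- Braid words on `n` strands.  The letter `(i, true)` is the elementary braid `σ_{i+1}`, which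
exchanges the strands in the positions `i` and `i + 1` (positions are counted from `0`), and
`(i, false)` is its inverse. -/
abbrev BraidWord (n : ℕ) : Type := List (Fin (n - 1) × Bool)

/-- The lower one of the two positions that the `i`-th elementary braid exchanges. -/
def lowPos {n : ℕ} (i : Fin (n - 1)) : Fin n := ⟨i, by have := i.isLt; omega⟩

/-- The upper one of the two positions that the `i`-th elementary braid exchanges. -/
def highPos {n : ℕ} (i : Fin (n - 1)) : Fin n := ⟨i + 1, by have := i.isLt; omega⟩

/-- The permutation of a braid word: the strand that starts in position `x` ends in position
`braidPerm w x`. -/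
def braidPerm {n : ℕ} : BraidWord n → Equiv.Perm (Fin n)
  | [] => 1
  | l :: w => braidPerm w * Equiv.swap (lowPos l.1) (highPos l.1)

/-- The position, after the first `k` letters of `w`, of the strand that starts in position `x`. -/
def strandPos {n : ℕ} (w : BraidWord n) (x : Fin n) (k : ℕ) : Fin n :=
  braidPerm (w.take k) x

/-- The strand in position `y` is the overcrossing strand of the letter `l`: in `σ_i` the strand
that moves to the higher position is on top, in `σ_i⁻¹` the other one. -/
def IsOver {n : ℕ} (l : Fin (n - 1) × Bool) (y : Fin n) : Prop :=
  y = if l.2 then lowPos l.1 else highPos l.1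

/-- Distance from the axis of the strand of the closed braid that starts in position `x`.  The
letter number `k` (from `0`) is drawn at the times in `[k, k + 1]`, and the position `y` is
the distance `y + 1`. -/
def strandRadius {n : ℕ} (w : BraidWord n) (x : Fin n) (u : ℝ) : ℝ :=
  1 + (x : ℝ) + ∑ k : Fin w.length,
    (((strandPos w x (k + 1) : ℕ) : ℝ) - ((strandPos w x k : ℕ) : ℝ)) *
      Real.smoothTransition (u - (k : ℕ))

open Classical in
/-- Height of the strand of the closed braid that starts in position `x`: it is `0`, except that
the overcrossing strand of every letter is lifted while that letter is drawn. -/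
def strandHeight {n : ℕ} (w : BraidWord n) (x : Fin n) (u : ℝ) : ℝ :=
  ∑ k : Fin w.length, if IsOver (w.get k) (strandPos w x k) then
    Real.smoothTransition (u - (k : ℕ)) * Real.smoothTransition (1 - (u - (k : ℕ))) else 0

/-- The components of the closure of a braid word are the cycles (fixed points included) of its
permutation. -/
abbrev Component {n : ℕ} (w : BraidWord n) : Type :=
  Quotient (Equiv.Perm.SameCycle.setoid (braidPerm w))

/-- The closed braid curve that starts in position `x`, as a function of the number `v` of turns
around the axis.  Every turn runs once through the word, during the times from `0` to its length
`m`, and then, at the times from `m` to `m + 1`, along the crossingless arcs that close the braid.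
The turn number `⌊v⌋` starts in the position where the previous turn ended. -/
def closedStrand {n : ℕ} (w : BraidWord n) (x : Fin n) (v : ℝ) : ℂ × ℝ :=
  ((strandRadius w ((braidPerm w ^ ⌊v⌋) x) (Int.fract v * (w.length + 1)) : ℂ) *
      Complex.exp (2 * Real.pi * Complex.I * v),
    strandHeight w ((braidPerm w ^ ⌊v⌋) x) (Int.fract v * (w.length + 1)))

/-- The closure of a braid word.  A component that belongs to a cycle of length `l` closes up after
`l` turns. -/
def braidClosure {n : ℕ} (w : BraidWord n) : Curves (Component w) :=
  fun c s => closedStrand w c.out (Function.minimalPeriod (braidPerm w) c.out * s)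

/-- The toric braid `B(p, q) = (σ₁ σ₂ ⋯ σ_{p-1})^q`, as a braid word. -/
def toricBraid (p q : ℕ) : BraidWord p :=
  (List.replicate q (List.ofFn fun i : Fin (p - 1) => (i, true))).flatten

/-- The torus link `K(p, q)`, the closure of `B(p, q)`. -/
def torusLink (p q : ℕ) : Curves (Component (toricBraid p q)) :=
  braidClosure (toricBraid p q)

/-- Switch the crossings of a braid word whose numbers, counted from `1`, are in `S`. -/
def switchAt {n : ℕ} (w : BraidWord n) (S : Finset ℕ) : BraidWord n :=
  w.mapIdx fun k l => if k + 1 ∈ S then (l.1, !l.2) else l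

/-- `S` is an unknotting crossing data for the braid word `w`: a subsequence of its crossing data
`1, 2, …, m` such that switching these crossings makes the closure an unknot or unlink. -/
def IsUnknottingCrossingData {n : ℕ} (w : BraidWord n) (S : Finset ℕ) : Prop :=
  S ⊆ Finset.Icc 1 w.length ∧ IsUnlink (braidClosure (switchAt w S))

/-- An unknotting crossing data is minimal if its number of elements is the unknotting number of
the closure. -/
def IsMinimalUnknottingCrossingData {n : ℕ} (w : BraidWord n) (S : Finset ℕ) : Prop :=
  IsUnknottingCrossingData w S ∧ IsUnknottingNumber (braidClosure w) S.card

/-- The U-crossing data of `B(p, q)`, for `1 ≤ q ≤ p`: from the `k`-th factor `σ₁ σ₂ ⋯ σ_{p-1}`, with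
the crossings `(k - 1)(p - 1) + 1, …, k(p - 1)`, it takes the last `k - 1` crossings
`k(p - 1) - (k - 2), …, k(p - 1)`. -/
def UCrossingData (p q : ℕ) : Finset ℕ :=
  (Finset.Icc 1 q).biUnion fun k => (Finset.range (k - 1)).image fun j => k * (p - 1) - j

end

end TorusLinks

/-!
The torus link `K(p, p)` is the closure of the full twist, a pure braid: its `p` components are the
closed strands, and every two of them cross exactly twice, both times positively.

**Lower bound.** Every two components are linked, while the components of an unlink are not, and
switching a crossing affects only the pair of components that meet there.  So at least one crossing
has to be switched for each of the `p (p - 1) / 2` pairs, and since a diagram has no triple points,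
these crossings are different (`choose_two_le_of_canBeUnlinkedBy`).  The invariant is a form of the
Gauss linking integral: the solid angle `∫∫ det (f, ∂ₛ f, ∂ₜ f) / |f|³` of the map `f` from the
torus to `ℝ³ \ {0}` that is given by the vectors from one component to the other.

* It is invariant under homotopies, because the solid angle form is closed; this is the divergence
  theorem on a box (`solidAngle_eq_of_homotopy`).
* It vanishes for circles in a plane.
* If no mutual crossing of two components is switched, then moving their heights linearly is a
  homotopy that keeps them disjoint (`linkingAngle_eq_of_same_crossings`).
* For two strands of `K(p, p)` it is not zero.  The vector from one strand to the other, seen in the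
  half plane that rotates around the axis with them, turns once clockwise around the origin.  The
  map `f` is therefore linearly homotopic to an explicit surface on which the solid angle form has
  a constant sign (`linkingAngle_ne_zero_of_loop`, `linkingAngle_strandCurve_ne_zero`).

**Upper bound.** In the factor number `k` of `B(p, p)`, a single strand, the one that starts in the
position `k` (from `1`), passes over all the other strands.  The last `k - 1` of these crossings,
which are switched, are those with the strands that start below it (`crossAt_toricBraid`).  So after
the switch, at every crossing the strand that starts in the lower position is on top
(`switchAt_toricBraid_layered`); the strands can be lifted into separate layers, straightened and
moved apart (`isUnlink_strandCurves`).  The closed braid itself is a diagram whose crossings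
correspond to the letters (`isDiagram_strandCurves`, `encard_switchedCrossings`).
-/

namespace TorusLinks

open scoped ContDiff

noncomputable section

/-! ### The solid angle of a doubly periodic surface -/

/-- The determinant of three vectors of `ℝ³ = ℂ × ℝ`. -/
def tripleProduct (P X Y : ℂ × ℝ) : ℝ :=
  P.1.re * (X.1.im * Y.2 - X.2 * Y.1.im) + P.1.im * (X.2 * Y.1.re - X.1.re * Y.2) +
    P.2 * (X.1.re * Y.1.im - X.1.im * Y.1.re)

/-- The square of the Euclidean norm of `ℝ³ = ℂ × ℝ` (the norm of the product type is the maximum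
norm). -/
def sqNorm (P : ℂ × ℝ) : ℝ := P.1.re ^ 2 + P.1.im ^ 2 + P.2 ^ 2

/-- The solid angle form at `P`, evaluated at the tangent vectors `X` and `Y`. -/
def solidAngleForm (P X Y : ℂ × ℝ) : ℝ := tripleProduct P X Y / √(sqNorm P) ^ 3

theorem sqNorm_pos {P : ℂ × ℝ} (hP : P ≠ 0) : 0 < sqNorm P := by
  rcases P with ⟨⟨a, b⟩, c⟩
  simp only [sqNorm]
  by_contra h
  apply hP
  have ha : a = 0 := by nlinarith [sq_nonneg a, sq_nonneg b, sq_nonneg c]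
  have hb : b = 0 := by nlinarith [sq_nonneg a, sq_nonneg b, sq_nonneg c]
  have hc : c = 0 := by nlinarith [sq_nonneg a, sq_nonneg b, sq_nonneg c]
  subst ha hb hc
  rfl

theorem contDiffAt_sqrt_sqNorm {P : ℂ × ℝ} (hP : P ≠ 0) :
    ContDiffAt ℝ ∞ (fun P : ℂ × ℝ => √(sqNorm P)) P := by
  have h : ContDiffAt ℝ ∞ sqNorm P := by
    have h1 : ContDiff ℝ ∞ fun P : ℂ × ℝ => P.1.re := Complex.reCLM.contDiff.comp contDiff_fst
    have h2 : ContDiff ℝ ∞ fun P : ℂ × ℝ => P.1.im := Complex.imCLM.contDiff.comp contDiff_fst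
    have h3 : ContDiff ℝ ∞ fun P : ℂ × ℝ => P.2 := contDiff_snd
    exact (((h1.pow 2).add (h2.pow 2)).add (h3.pow 2)).contDiffAt
  exact h.sqrt (sqNorm_pos hP).ne'

section
variable {E : Type*} [NormedAddCommGroup E] [NormedSpace ℝ E]

theorem contDiffAt_solidAngleForm {P X Y : E → ℂ × ℝ} {q : E} (hP : ContDiffAt ℝ ∞ P q)
    (hX : ContDiffAt ℝ ∞ X q) (hY : ContDiffAt ℝ ∞ Y q) (h0 : P q ≠ 0) :
    ContDiffAt ℝ ∞ (fun q => solidAngleForm (P q) (X q) (Y q)) q := by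
  have re : ∀ {Z : E → ℂ × ℝ}, ContDiffAt ℝ ∞ Z q → ContDiffAt ℝ ∞ (fun q => (Z q).1.re) q :=
    fun hZ => Complex.reCLM.contDiff.contDiffAt.comp q hZ.fst
  have im : ∀ {Z : E → ℂ × ℝ}, ContDiffAt ℝ ∞ Z q → ContDiffAt ℝ ∞ (fun q => (Z q).1.im) q :=
    fun hZ => Complex.imCLM.contDiff.contDiffAt.comp q hZ.fst
  have ht : ∀ {Z : E → ℂ × ℝ}, ContDiffAt ℝ ∞ Z q → ContDiffAt ℝ ∞ (fun q => (Z q).2) q :=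
    fun hZ => hZ.snd
  have hs : ContDiffAt ℝ ∞ (fun q => √(sqNorm (P q))) q :=
    ContDiffAt.comp (g := fun P : ℂ × ℝ => √(sqNorm P)) q (contDiffAt_sqrt_sqNorm h0) hP
  refine ContDiffAt.div ?_ (hs.pow 3) (pow_ne_zero 3 (Real.sqrt_pos.2 (sqNorm_pos h0)).ne')
  exact (((re hP).mul (((im hX).mul (ht hY)).sub ((ht hX).mul (im hY)))).add
    ((im hP).mul (((ht hX).mul (re hY)).sub ((re hX).mul (ht hY))))).add
    ((ht hP).mul (((re hX).mul (im hY)).sub ((im hX).mul (re hY))))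
end

/-- The derivative of the solid angle form along a curve of triples of vectors. -/
theorem hasDerivAt_solidAngleForm {P X Y : ℝ → ℂ × ℝ} {P' X' Y' : ℂ × ℝ} {r : ℝ}
    (hP : HasDerivAt P P' r) (hX : HasDerivAt X X' r) (hY : HasDerivAt Y Y' r) (h0 : P r ≠ 0) :
    HasDerivAt (fun r => solidAngleForm (P r) (X r) (Y r))
      ((sqNorm (P r) * (tripleProduct P' (X r) (Y r) + tripleProduct (P r) X' (Y r) +
          tripleProduct (P r) (X r) Y') -
        3 * ((P r).1.re * P'.1.re + (P r).1.im * P'.1.im + (P r).2 * P'.2) *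
          tripleProduct (P r) (X r) (Y r)) / √(sqNorm (P r)) ^ 5) r := by
  have re : ∀ {Z : ℝ → ℂ × ℝ} {Z' : ℂ × ℝ}, HasDerivAt Z Z' r →
      HasDerivAt (fun q => (Z q).1.re) Z'.1.re r := fun hZ =>
    (Complex.reCLM.hasFDerivAt.comp_hasDerivAt r
      ((ContinuousLinearMap.fst ℝ ℂ ℝ).hasFDerivAt.comp_hasDerivAt r hZ))
  have im : ∀ {Z : ℝ → ℂ × ℝ} {Z' : ℂ × ℝ}, HasDerivAt Z Z' r →
      HasDerivAt (fun q => (Z q).1.im) Z'.1.im r := fun hZ =>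
    (Complex.imCLM.hasFDerivAt.comp_hasDerivAt r
      ((ContinuousLinearMap.fst ℝ ℂ ℝ).hasFDerivAt.comp_hasDerivAt r hZ))
  have ht : ∀ {Z : ℝ → ℂ × ℝ} {Z' : ℂ × ℝ}, HasDerivAt Z Z' r →
      HasDerivAt (fun q => (Z q).2) Z'.2 r := fun hZ =>
    (ContinuousLinearMap.snd ℝ ℂ ℝ).hasFDerivAt.comp_hasDerivAt r hZ
  have hpos := sqNorm_pos h0
  have hsq : HasDerivAt (fun q => sqNorm (P q))
      (2 * ((P r).1.re * P'.1.re + (P r).1.im * P'.1.im + (P r).2 * P'.2)) r := by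
    have := (((re hP).pow 2).add ((im hP).pow 2)).add ((ht hP).pow 2)
    refine this.congr_deriv ?_
    push_cast
    ring
  have hs := hsq.sqrt hpos.ne'
  have hT := (((re hP).mul (((im hX).mul (ht hY)).sub ((ht hX).mul (im hY)))).add
    ((im hP).mul (((ht hX).mul (re hY)).sub ((re hX).mul (ht hY))))).add
    ((ht hP).mul (((re hX).mul (im hY)).sub ((im hX).mul (re hY))))
  have h := hT.div (hs.pow 3) (pow_ne_zero 3 (Real.sqrt_pos.2 hpos).ne')
  refine h.congr_deriv ?_
  have hr : 0 < √(sqNorm (P r)) := Real.sqrt_pos.2 hpos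
  have hr2 : sqNorm (P r) = √(sqNorm (P r)) ^ 2 := (Real.sq_sqrt hpos.le).symm
  simp only [Pi.add_apply, Pi.mul_apply, Pi.sub_apply, Pi.pow_apply]
  generalize √(sqNorm (P r)) = ρ at *
  rw [hr2]
  simp only [tripleProduct]
  field_simp
  push_cast
  ring

/-- The `k`-th partial derivative of a function on `ℝ³`. -/
def partialDeriv (k : Fin 3) (H : (Fin 3 → ℝ) → ℂ × ℝ) (q : Fin 3 → ℝ) : ℂ × ℝ :=
  fderiv ℝ H q (Pi.single k 1)

theorem contDiff_partialDeriv {H : (Fin 3 → ℝ) → ℂ × ℝ} (hH : ContDiff ℝ ∞ H) (k : Fin 3) :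
    ContDiff ℝ ∞ (partialDeriv k H) :=
  (hH.fderiv_right (m := ∞) (by simp)).clm_apply contDiff_const

theorem hasDerivAt_partialDeriv {H : (Fin 3 → ℝ) → ℂ × ℝ} (hH : ContDiff ℝ ∞ H) (k : Fin 3)
    (q : Fin 3 → ℝ) :
    HasDerivAt (fun r : ℝ => H (q + r • Pi.single k 1)) (partialDeriv k H q) 0 :=
  ((hH.differentiable (by simp)) q).hasFDerivAt.hasLineDerivAt _

theorem partialDeriv_comm {H : (Fin 3 → ℝ) → ℂ × ℝ} (hH : ContDiff ℝ ∞ H) (j k : Fin 3)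
    (q : Fin 3 → ℝ) :
    partialDeriv j (partialDeriv k H) q = partialDeriv k (partialDeriv j H) q := by
  have hd : DifferentiableAt ℝ (fderiv ℝ H) q :=
    ((hH.fderiv_right (m := ∞) (by simp)).differentiable (by simp)) q
  have key : ∀ a b : Fin 3, partialDeriv a (partialDeriv b H) q =
      fderiv ℝ (fderiv ℝ H) q (Pi.single a 1) (Pi.single b 1) := by
    intro a b
    have := (hd.hasFDerivAt.clm_apply (hasFDerivAt_const (Pi.single b 1 : Fin 3 → ℝ) q)).fderiv
    simp only [partialDeriv]
    rw [show partialDeriv b H = fun q => fderiv ℝ H q (Pi.single b 1) from rfl, this]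
    simp
  rw [key, key]
  exact (hH.contDiffAt.isSymmSndFDerivAt
    (by simpa using WithTop.coe_le_coe.2 (le_top : (2 : ℕ∞) ≤ ⊤))) _ _

/-- The solid angle form pulled back along `H`, as a vector field: its component `k` is the
coefficient of `dq (k+1) ∧ dq (k+2)`. -/
def solidAngleField (H : (Fin 3 → ℝ) → ℂ × ℝ) (k : Fin 3) (q : Fin 3 → ℝ) : ℝ :=
  solidAngleForm (H q) (partialDeriv (k + 1) H q) (partialDeriv (k + 2) H q)

theorem contDiffAt_solidAngleField {H : (Fin 3 → ℝ) → ℂ × ℝ} (hH : ContDiff ℝ ∞ H) (k : Fin 3)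
    {q : Fin 3 → ℝ} (h0 : H q ≠ 0) : ContDiffAt ℝ ∞ (solidAngleField H k) q :=
  contDiffAt_solidAngleForm hH.contDiffAt (contDiff_partialDeriv hH _).contDiffAt
    (contDiff_partialDeriv hH _).contDiffAt h0

/-- The solid angle form is closed. -/
theorem sum_fderiv_solidAngleField {H : (Fin 3 → ℝ) → ℂ × ℝ} (hH : ContDiff ℝ ∞ H)
    {q : Fin 3 → ℝ} (h0 : H q ≠ 0) :
    ∑ k, fderiv ℝ (solidAngleField H k) q (Pi.single k 1) = 0 := by
  have key : ∀ k : Fin 3, fderiv ℝ (solidAngleField H k) q (Pi.single k 1) = _ := fun k =>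
    HasDerivAt.unique
      (((contDiffAt_solidAngleField hH k h0).differentiableAt
        (by simp)).hasFDerivAt.hasLineDerivAt (Pi.single k 1))
      (hasDerivAt_solidAngleForm (hasDerivAt_partialDeriv hH k q)
        (hasDerivAt_partialDeriv (contDiff_partialDeriv hH (k + 1)) k q)
        (hasDerivAt_partialDeriv (contDiff_partialDeriv hH (k + 2)) k q)
        (by simpa using h0))
  simp only [Fin.sum_univ_three, key, zero_smul, add_zero]
  simp only [show (0 : Fin 3) + 1 = 1 from rfl, show (0 : Fin 3) + 2 = 2 from rfl,
    show (1 : Fin 3) + 1 = 2 from rfl, show (1 : Fin 3) + 2 = 0 from rfl,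
    show (2 : Fin 3) + 1 = 0 from rfl, show (2 : Fin 3) + 2 = 1 from rfl]
  rw [partialDeriv_comm hH 1 0, partialDeriv_comm hH 2 0, partialDeriv_comm hH 2 1]
  rw [← add_div, ← add_div, div_eq_zero_iff]
  left
  simp only [sqNorm, tripleProduct]
  ring

/-- The solid angle swept out by a doubly periodic surface in `ℝ³`, which is `4π` times its degree
around the origin. -/
def solidAngle (f : ℝ → ℝ → ℂ × ℝ) : ℝ :=
  ∫ x in Set.Icc (0 : Fin 2 → ℝ) 1, solidAngleForm (f (x 0) (x 1))
    (deriv (fun s => f s (x 1)) (x 0)) (deriv (fun t => f (x 0) t) (x 1))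

theorem solidAngle_eq_of_homotopy {H : ℝ → ℝ → ℝ → ℂ × ℝ}
    (hH : ContDiff ℝ ∞ fun q : ℝ × ℝ × ℝ => H q.1 q.2.1 q.2.2)
    (h1 : ∀ τ s t, H τ (s + 1) t = H τ s t) (h2 : ∀ τ s t, H τ s (t + 1) = H τ s t)
    (h0 : ∀ τ ∈ Set.Icc (0 : ℝ) 1, ∀ s t, H τ s t ≠ 0) :
    solidAngle (H 0) = solidAngle (H 1) := by
  set G : (Fin 3 → ℝ) → ℂ × ℝ := fun q => H (q 0) (q 1) (q 2) with hG
  have hGs : ContDiff ℝ ∞ G :=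
    hH.comp ((contDiff_apply ℝ ℝ (0 : Fin 3)).prodMk
      ((contDiff_apply ℝ ℝ (1 : Fin 3)).prodMk (contDiff_apply ℝ ℝ (2 : Fin 3))))
  have hG0 : ∀ q ∈ Set.Icc (0 : Fin 3 → ℝ) 1, G q ≠ 0 := fun q hq =>
    h0 _ ⟨hq.1 0, hq.2 0⟩ _ _
  have per : ∀ (v : Fin 3 → ℝ), (∀ q, G (q + v) = G q) → ∀ k q,
      solidAngleField G k (q + v) = solidAngleField G k q := by
    intro v hv k q
    have hfd : fderiv ℝ G (q + v) = fderiv ℝ G q := by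
      rw [← fderiv_comp_add_right]
      congr 1
      exact funext hv
    simp only [solidAngleField, partialDeriv, hv, hfd]
  have per1 := per (Pi.single 1 1) fun q => by simp [hG, h1]
  have per2 := per (Pi.single 2 1) fun q => by simp [hG, h2]
  have hdiv := MeasureTheory.integral_divergence_of_hasFDerivAt_off_countable'
    (0 : Fin 3 → ℝ) 1 (fun _ => zero_le_one) (solidAngleField G)
    (fun k => fderiv ℝ (solidAngleField G k)) ∅ Set.countable_empty
    (fun k q hq => (contDiffAt_solidAngleField hGs k (hG0 q hq)).continuousAt.continuousWithinAt)
    (fun q hq k => by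
      have hq' : q ∈ Set.Icc (0 : Fin 3 → ℝ) 1 :=
        ⟨fun i => (hq.1 i trivial).1.le, fun i => (hq.1 i trivial).2.le⟩
      exact ((contDiffAt_solidAngleField hGs k (hG0 q hq')).differentiableAt
        (by simp)).hasFDerivAt)
    (by
      refine (MeasureTheory.integrableOn_zero).congr_fun (fun q hq => ?_) measurableSet_Icc
      exact (sum_fderiv_solidAngleField hGs (hG0 q hq)).symm)
  rw [MeasureTheory.setIntegral_congr_fun measurableSet_Icc
    (g := fun _ => (0 : ℝ)) (fun q hq => sum_fderiv_solidAngleField hGs (hG0 q hq))] at hdiv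
  simp only [MeasureTheory.integral_zero] at hdiv
  replace hdiv := hdiv.trans (Fin.sum_univ_three _)
  have face : ∀ k : Fin 3,
      (∀ q, solidAngleField G k (q + Pi.single k 1) = solidAngleField G k q) →
      ∀ x : Fin 2 → ℝ, solidAngleField G k (Fin.insertNth k ((1 : Fin 3 → ℝ) k) x) =
        solidAngleField G k (Fin.insertNth k ((0 : Fin 3 → ℝ) k) x) := by
    intro k hk x
    rw [← hk (Fin.insertNth k ((0 : Fin 3 → ℝ) k) x)]
    congr 1
    ext j
    rcases Fin.eq_self_or_eq_succAbove k j with rfl | ⟨i, rfl⟩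
    · simp
    · simp [Fin.succAbove_ne]
  -- By periodicity, opposite faces cancel in the directions of the torus.
  simp only [face 1 (per1 1), face 2 (per2 2), sub_self, add_zero] at hdiv
  have slice : ∀ τ : ℝ, solidAngle (H τ) =
      ∫ x in Set.Icc ((0 : Fin 3 → ℝ) ∘ Fin.succAbove 0) ((1 : Fin 3 → ℝ) ∘ Fin.succAbove 0),
        solidAngleField G 0 (Fin.insertNth 0 τ x) := by
    intro τ
    refine MeasureTheory.setIntegral_congr_fun measurableSet_Icc fun x _ => ?_
    set q : Fin 3 → ℝ := Fin.insertNth 0 τ x with hq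
    have q0 : q 0 = τ := by simp [hq]
    have q1 : q 1 = x 0 := by simp [hq]
    have q2 : q 2 = x 1 := by simp [hq]; rfl
    have d1 : deriv (fun s => H τ s (x 1)) (x 0) = partialDeriv 1 G q := by
      have h := HasDerivAt.comp_sub_const (x 0) (x 0)
        (by simpa using hasDerivAt_partialDeriv hGs 1 q)
      refine (h.congr_of_eventuallyEq (Filter.Eventually.of_forall fun s => ?_)).deriv
      simp [hG, q0, q1, q2]
    have d2 : deriv (fun t => H τ (x 0) t) (x 1) = partialDeriv 2 G q := by
      have h := HasDerivAt.comp_sub_const (x 1) (x 1)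
        (by simpa using hasDerivAt_partialDeriv hGs 2 q)
      refine (h.congr_of_eventuallyEq (Filter.Eventually.of_forall fun t => ?_)).deriv
      simp [hG, q0, q1, q2]
    simp only [solidAngleField, d1, d2]
    rw [show (0 : Fin 3) + 1 = 1 from rfl, show (0 : Fin 3) + 2 = 2 from rfl]
    simp [hG, q0, q1, q2]
  rw [slice 0, slice 1]
  simp only [Pi.zero_apply, Pi.one_apply] at hdiv
  linarith

/-! ### Linking numbers and crossing switches -/

/-- The point of the unit circle that is reached after `s` turns. -/
def turn (s : ℝ) : ℂ := Complex.exp (2 * Real.pi * Complex.I * s)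

theorem contDiff_turn : ContDiff ℝ ∞ turn :=
  (contDiff_const.mul Complex.ofRealCLM.contDiff).cexp

theorem turn_eq (s : ℝ) :
    turn s = Real.cos (2 * Real.pi * s) + Real.sin (2 * Real.pi * s) * Complex.I := by
  rw [turn, show 2 * (Real.pi : ℂ) * Complex.I * s = ((2 * Real.pi * s : ℝ) : ℂ) * Complex.I by
    push_cast; ring, Complex.exp_mul_I]
  push_cast
  rfl

theorem turn_re (s : ℝ) : (turn s).re = Real.cos (2 * Real.pi * s) := by
  simp [turn_eq, -Complex.ofReal_cos, -Complex.ofReal_sin]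

theorem turn_im (s : ℝ) : (turn s).im = Real.sin (2 * Real.pi * s) := by
  simp [turn_eq, -Complex.ofReal_cos, -Complex.ofReal_sin]

theorem turn_add (s t : ℝ) : turn (s + t) = turn s * turn t := by
  simp only [turn, ← Complex.exp_add]
  push_cast
  ring_nf

theorem turn_zero : turn 0 = 1 := by simp [turn]

theorem turn_one : turn 1 = 1 := by simp [turn]

theorem turn_add_one (s : ℝ) : turn (s + 1) = turn s := by rw [turn_add, turn_one, mul_one]

theorem norm_turn (s : ℝ) : ‖turn s‖ = 1 := by
  rw [turn, show 2 * (Real.pi : ℂ) * Complex.I * s = ((2 * Real.pi * s : ℝ) : ℂ) * Complex.I by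
    push_cast; ring, Complex.norm_exp_ofReal_mul_I]

theorem turn_ne_zero (s : ℝ) : turn s ≠ 0 := Complex.exp_ne_zero _

theorem turn_eq_turn {s t : ℝ} (h : turn s = turn t) : ∃ k : ℤ, t = s + k := by
  obtain ⟨k, hk⟩ := Complex.exp_eq_exp_iff_exists_int.1 h
  refine ⟨-k, ?_⟩
  have h2 : (2 * Real.pi * Complex.I : ℂ) ≠ 0 := by simp [Real.pi_ne_zero]
  have h3 : (2 * Real.pi * Complex.I : ℂ) * s = 2 * Real.pi * Complex.I * (t + k) := by
    rw [hk]; ring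
  have h4 : (s : ℂ) = t + k := mul_left_cancel₀ h2 h3
  have h5 : s = t + k := by exact_mod_cast h4
  push_cast
  linarith

theorem hasDerivAt_turn (s : ℝ) : HasDerivAt turn (2 * Real.pi * Complex.I * turn s) s := by
  have h1 : HasDerivAt (fun s : ℝ => 2 * Real.pi * Complex.I * (s : ℂ))
      (2 * Real.pi * Complex.I) s := by
    simpa using (Complex.ofRealCLM.hasDerivAt (x := s)).const_mul (2 * Real.pi * Complex.I : ℂ)
  exact h1.cexp.congr_deriv (by rw [turn, mul_comm])

/-- The vectors from the second curve to the first one, in a frame that turns around the axis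
together with the second curve. -/
def twistedDifference (a b : ℝ → ℂ × ℝ) (u t : ℝ) : ℂ × ℝ :=
  (turn (-t) * ((a (u + t)).1 - (b t).1), (a (u + t)).2 - (b t).2)

/-- Twisting by `turn` and the shear `(u, t) ↦ (u + t, t)` do not change the degree, so for disjoint
closed curves this is `4π` times their linking number, up to sign. -/
def linkingAngle (a b : ℝ → ℂ × ℝ) : ℝ := solidAngle (twistedDifference a b)

/-- Closed curves that stay disjoint, but may cross themselves, keep their linking number. -/
theorem linkingAngle_eq_of_homotopy {A B : ℝ → ℝ → ℂ × ℝ}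
    (hA : ContDiff ℝ ∞ fun q : ℝ × ℝ => A q.1 q.2) (hB : ContDiff ℝ ∞ fun q : ℝ × ℝ => B q.1 q.2)
    (pA : ∀ τ ∈ Set.Icc (0 : ℝ) 1, ∀ s, A τ (s + 1) = A τ s)
    (pB : ∀ τ ∈ Set.Icc (0 : ℝ) 1, ∀ s, B τ (s + 1) = B τ s)
    (hAB : ∀ τ ∈ Set.Icc (0 : ℝ) 1, ∀ s t, A τ s ≠ B τ t) :
    linkingAngle (A 0) (B 0) = linkingAngle (A 1) (B 1) := by
  -- `smoothTransition` keeps the time in `[0, 1]`, where the curves are known to be closed.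
  have hI : ∀ τ, Real.smoothTransition τ ∈ Set.Icc (0 : ℝ) 1 := fun τ =>
    ⟨Real.smoothTransition.nonneg τ, Real.smoothTransition.le_one τ⟩
  have h := solidAngle_eq_of_homotopy
    (H := fun τ => twistedDifference (A (Real.smoothTransition τ)) (B (Real.smoothTransition τ)))
    ?_ ?_ ?_ ?_
  · simpa [linkingAngle] using h
  · have hT : ContDiff ℝ ∞ fun q : ℝ × ℝ × ℝ => Real.smoothTransition q.1 :=
      Real.smoothTransition.contDiff.comp contDiff_fst
    have hA' := hA.comp (hT.prodMk (contDiff_snd.fst.add contDiff_snd.snd))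
    have hB' := hB.comp (hT.prodMk contDiff_snd.snd)
    exact ((contDiff_turn.comp contDiff_snd.snd.neg).mul (hA'.fst.sub hB'.fst)).prodMk
      (hA'.snd.sub hB'.snd)
  · intro τ s t
    simp only [twistedDifference, add_right_comm s 1 t, pA _ (hI τ)]
  · intro τ s t
    have : turn (-(t + 1)) = turn (-t) := by
      rw [← turn_add_one (-(t + 1))]; congr 1; ring
    simp only [twistedDifference, ← add_assoc, pA _ (hI τ), pB _ (hI τ), this]
  · intro τ _ s t h
    simp only [twistedDifference, Prod.mk_eq_zero, mul_eq_zero, turn_ne_zero, false_or,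
      sub_eq_zero] at h
    exact hAB _ (hI τ) _ _ (Prod.ext h.1 h.2)

theorem linkingAngle_eq_of_isotopic {ι : Type} {L L' : Curves ι} (h : Isotopic L L') {i j : ι}
    (hij : i ≠ j) : linkingAngle (L i) (L j) = linkingAngle (L' i) (L' j) := by
  obtain ⟨F, hF, hL, rfl, rfl⟩ := h
  exact linkingAngle_eq_of_homotopy (A := fun τ => F τ i) (B := fun τ => F τ j) (hF i) (hF j)
    (fun τ hτ => (hL τ hτ).periodic i) (fun τ hτ => (hL τ hτ).periodic j)
    (fun τ hτ s t hst => hij ((hL τ hτ).injective i s j t hst).1)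

/-- If no crossing of `a` and `b` is switched, then moving the heights linearly keeps the curves
disjoint. -/
theorem linkingAngle_eq_of_same_crossings {a b a' b' : ℝ → ℂ × ℝ}
    (ha : ContDiff ℝ ∞ a) (hb : ContDiff ℝ ∞ b) (ha' : ContDiff ℝ ∞ a') (hb' : ContDiff ℝ ∞ b')
    (pa : ∀ s, a (s + 1) = a s) (pb : ∀ s, b (s + 1) = b s)
    (pa' : ∀ s, a' (s + 1) = a' s) (pb' : ∀ s, b' (s + 1) = b' s)
    (hpa : ∀ s, (a' s).1 = (a s).1) (hpb : ∀ s, (b' s).1 = (b s).1)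
    (h : ∀ s t, (a s).1 = (b t).1 → ((a s).2 < (b t).2 ∧ (a' s).2 < (b' t).2) ∨
      ((b t).2 < (a s).2 ∧ (b' t).2 < (a' s).2)) :
    linkingAngle a b = linkingAngle a' b' := by
  have key := linkingAngle_eq_of_homotopy
    (A := fun τ s => ((a s).1, (1 - τ) * (a s).2 + τ * (a' s).2))
    (B := fun τ s => ((b s).1, (1 - τ) * (b s).2 + τ * (b' s).2)) ?_ ?_ ?_ ?_ ?_
  · have e1 : (fun s => ((a s).1, (a' s).2)) = a' := funext fun s => by rw [← hpa]
    have e2 : (fun s => ((b s).1, (b' s).2)) = b' := funext fun s => by rw [← hpb]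
    simpa [e1, e2] using key
  · exact (ha.fst.comp contDiff_snd).prodMk
      (((contDiff_const.sub contDiff_fst).mul (ha.snd.comp contDiff_snd)).add
        (contDiff_fst.mul (ha'.snd.comp contDiff_snd)))
  · exact (hb.fst.comp contDiff_snd).prodMk
      (((contDiff_const.sub contDiff_fst).mul (hb.snd.comp contDiff_snd)).add
        (contDiff_fst.mul (hb'.snd.comp contDiff_snd)))
  · intro τ _ s
    simp only [pa, pa']
  · intro τ _ s
    simp only [pb, pb']
  · rintro τ ⟨h0, h1⟩ s t hst
    simp only [Prod.mk.injEq] at hst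
    rcases h s t hst.1 with ⟨h2, h3⟩ | ⟨h2, h3⟩
    · rcases h0.eq_or_lt with rfl | h0
      · linarith
      · nlinarith [mul_pos h0 (sub_pos.2 h3), mul_nonneg (sub_nonneg.2 h1) (sub_pos.2 h2).le]
    · rcases h0.eq_or_lt with rfl | h0
      · linarith
      · nlinarith [mul_pos h0 (sub_pos.2 h3), mul_nonneg (sub_nonneg.2 h1) (sub_pos.2 h2).le]

theorem linkingAngle_roundCircles {ι : Type} (c : ι → ℕ) (i j : ι) :
    linkingAngle (roundCircles c i) (roundCircles c j) = 0 := by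
  have hd : Differentiable ℝ fun s : ℝ => Complex.exp (2 * Real.pi * Complex.I * s) :=
    contDiff_turn.differentiable (by simp)
  have ht : Differentiable ℝ turn := hd
  refine MeasureTheory.setIntegral_eq_zero_of_forall_eq_zero fun x _ => ?_
  have snd0 : ∀ {g : ℝ → ℂ} (_ : Differentiable ℝ g) (r : ℝ),
      deriv (fun s => (g s, (0 : ℝ))) r = (deriv g r, 0) := fun hg r =>
    ((hg r).hasDerivAt.prodMk (hasDerivAt_const r (0 : ℝ))).deriv
  simp only [twistedDifference, roundCircles, sub_self]
  rw [snd0, snd0]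
  · simp [solidAngleForm, tripleProduct]
  · refine (ht.comp differentiable_neg).mul (Differentiable.sub ?_ ?_)
    · exact (differentiable_const _).add (hd.comp (differentiable_id.const_add _))
    · exact (differentiable_const _).add hd
  · refine (differentiable_const _).mul (Differentiable.sub ?_ (differentiable_const _))
    exact (differentiable_const _).add (hd.comp (differentiable_id.add_const _))

/-- Unlinking two linked components requires switching one of their mutual crossings. -/
theorem exists_mem_switchedCrossings {ι : Type} {K L L' : Curves ι} (hKL : Isotopic K L)
    (hproj : ∀ i s, (L' i s).1 = (L i s).1) (hU : IsUnlink L') {i j : ι} (hij : i ≠ j)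
    (hK : linkingAngle (K i) (K j) ≠ 0) :
    ∃ s t, (L i s).1 = (L j t).1 ∧ (L i s).1 ∈ switchedCrossings L L' := by
  by_contra hcon
  push Not at hcon
  apply hK
  obtain ⟨c, -, hc⟩ := hU
  rw [linkingAngle_eq_of_isotopic hKL hij, ← linkingAngle_roundCircles c i j,
    ← linkingAngle_eq_of_isotopic hc hij]
  have hL : IsLink L := by
    obtain ⟨F, -, hF, -, rfl⟩ := hKL
    exact hF 1 (by simp)
  have hL' : IsLink L' := by
    obtain ⟨F, -, hF, rfl, -⟩ := hc
    exact hF 0 (by simp)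
  refine linkingAngle_eq_of_same_crossings (hL.smooth i) (hL.smooth j) (hL'.smooth i)
    (hL'.smooth j) (hL.periodic i) (hL.periodic j) (hL'.periodic i) (hL'.periodic j)
    (hproj i) (hproj j) fun s t hst => ?_
  have n1 : (L i s).2 ≠ (L j t).2 := fun h =>
    hij (hL.injective i s j t (Prod.ext hst h)).1
  have n2 : (L' i s).2 ≠ (L' j t).2 := fun h =>
    hij (hL'.injective i s j t (Prod.ext (by rw [hproj, hproj, hst]) h)).1
  have hnot := hcon s t hst
  rcases lt_or_gt_of_ne n1 with h1 | h1 <;> rcases lt_or_gt_of_ne n2 with h2 | h2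
  · exact Or.inl ⟨h1, h2⟩
  · exact absurd ⟨i, s, j, t, rfl, hst.symm, h1, h2⟩ hnot
  · exact absurd ⟨j, t, i, s, hst.symm, rfl, h1, h2⟩ hnot
  · exact Or.inr ⟨h1, h2⟩

/-- A link whose components are pairwise linked needs at least one crossing switch for every pair
of components. -/
theorem choose_two_le_of_canBeUnlinkedBy {ι : Type} [Fintype ι] {K : Curves ι}
    (hK : ∀ i j, i ≠ j → linkingAngle (K i) (K j) ≠ 0 ∨ linkingAngle (K j) (K i) ≠ 0) {k : ℕ}
    (hk : CanBeUnlinkedBy K k) : (Fintype.card ι).choose 2 ≤ k := by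
  classical
  obtain ⟨L, L', hKL, hD, hproj, hcard, hU⟩ := hk
  have hex : ∀ P ∈ Finset.powersetCard 2 (Finset.univ : Finset ι), ∃ z ∈ switchedCrossings L L',
      ∃ i j s t, i ≠ j ∧ P = {i, j} ∧ (L i s).1 = z ∧ (L j t).1 = z := by
    intro P hP
    obtain ⟨i, j, hij, rfl⟩ := Finset.card_eq_two.1 (Finset.mem_powersetCard.1 hP).2
    rcases hK i j hij with h | h
    · obtain ⟨s, t, hst, hz⟩ := exists_mem_switchedCrossings hKL hproj hU hij h
      exact ⟨_, hz, i, j, s, t, hij, rfl, rfl, hst.symm⟩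
    · obtain ⟨s, t, hst, hz⟩ := exists_mem_switchedCrossings hKL hproj hU hij.symm h
      exact ⟨_, hz, i, j, t, s, hij, rfl, hst.symm, rfl⟩
  choose! z hz hz' using hex
  have hinj : Set.InjOn z (Finset.powersetCard 2 (Finset.univ : Finset ι)) := by
    intro P hP Q hQ hPQ
    obtain ⟨i, j, s, t, hij, hPe, hi, hj⟩ := hz' P hP
    obtain ⟨k, l, u, v, hkl, hQe, hk, hl⟩ := hz' Q hQ
    -- There are no triple points, so every component through `z P` belongs to `P`.
    have third : ∀ m w, (L m w).1 = z P → m ∈ P := by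
      intro m w hm
      rcases hD.no_triple i s j t m w (by rw [hi, hj]) (by rw [hj, hm]) with h | h | h
      · exact absurd h.1 hij
      · simp [hPe, h.1]
      · simp [hPe, h.1]
    refine (Finset.eq_of_subset_of_card_le (fun m hm => ?_) ?_).symm
    · rw [hQe] at hm
      rcases Finset.mem_insert.1 hm with rfl | hm
      · exact third _ u (by rw [hk, hPQ])
      · rw [Finset.mem_singleton.1 hm]
        exact third _ v (by rw [hl, hPQ])
    · rw [(Finset.mem_powersetCard.1 hP).2, (Finset.mem_powersetCard.1 hQ).2]
  have h1 : ((Finset.powersetCard 2 (Finset.univ : Finset ι)).image z : Set ℂ) ⊆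
      switchedCrossings L L' := by
    intro w hw
    obtain ⟨P, hP, rfl⟩ := Finset.mem_image.1 (Finset.mem_coe.1 hw)
    exact hz P hP
  have h2 := Set.encard_le_encard h1
  rw [hcard, Set.encard_coe_eq_coe_finsetCard, Finset.card_image_of_injOn hinj,
    Finset.card_powersetCard, Finset.card_univ] at h2
  exact_mod_cast h2

/-! ### Strands around a common axis that are linked -/

theorem deriv_smoothTransition_nonneg (x : ℝ) : 0 ≤ deriv Real.smoothTransition x :=
  Real.smoothTransition.monotone.deriv_nonneg

theorem hasDerivAt_smoothTransition (x : ℝ) :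
    HasDerivAt Real.smoothTransition (deriv Real.smoothTransition x) x :=
  ((Real.smoothTransition.contDiff (n := 1)).differentiable (by simp) x).hasDerivAt

theorem deriv_smoothTransition_of_nonpos {x : ℝ} (hx : x ≤ 0) :
    deriv Real.smoothTransition x = 0 := by
  refine IsLocalMin.deriv_eq_zero (Filter.Eventually.of_forall fun y => ?_)
  rw [Real.smoothTransition.zero_of_nonpos hx]
  exact Real.smoothTransition.nonneg y

theorem deriv_smoothTransition_of_one_le {x : ℝ} (hx : 1 ≤ x) :
    deriv Real.smoothTransition x = 0 := by
  refine IsLocalMax.deriv_eq_zero (Filter.Eventually.of_forall fun y => ?_)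
  rw [Real.smoothTransition.one_of_one_le hx]
  exact Real.smoothTransition.le_one y

/-- The surface over the torus whose part with `cos (2π u) > 0` is swept out by the loop `(A, B)`
in a half plane, scaled by a factor that shrinks while the loop moves in the orthogonal direction;
its part with `cos (2π u) ≤ 0` is a curve that leads back. -/
def loopSurface (A B : ℝ → ℝ) (u t : ℝ) : ℂ × ℝ :=
  (((Real.smoothTransition (Real.cos (2 * Real.pi * u)) * A t -
      Real.smoothTransition (-Real.cos (2 * Real.pi * u)) : ℝ) : ℂ) +
      (Real.sin (2 * Real.pi * u) : ℝ) * Complex.I,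
    Real.smoothTransition (Real.cos (2 * Real.pi * u)) * B t)

theorem contDiff_loopSurface {A B : ℝ → ℝ} (hA : ContDiff ℝ ∞ A) (hB : ContDiff ℝ ∞ B) :
    ContDiff ℝ ∞ fun q : ℝ × ℝ => loopSurface A B q.1 q.2 := by
  have hc : ContDiff ℝ ∞ fun q : ℝ × ℝ => Real.cos (2 * Real.pi * q.1) :=
    Real.contDiff_cos.comp (contDiff_const.mul contDiff_fst)
  have hs : ContDiff ℝ ∞ fun q : ℝ × ℝ => Real.sin (2 * Real.pi * q.1) :=
    Real.contDiff_sin.comp (contDiff_const.mul contDiff_fst)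
  have h1 := Real.smoothTransition.contDiff.comp hc
  have h2 := Real.smoothTransition.contDiff.comp hc.neg
  exact ((Complex.ofRealCLM.contDiff.comp ((h1.mul (hA.comp contDiff_snd)).sub h2)).add
    ((Complex.ofRealCLM.contDiff.comp hs).mul contDiff_const)).prodMk
      (h1.mul (hB.comp contDiff_snd))

/-- The solid angle form of the surface is a nonnegative multiple of the rate `A B' - B A'` at which
the loop turns around the origin: both terms of the multiple, from the growth of `sin` and from the
shrinking of the scaling factor, have the same sign. -/
theorem tripleProduct_loopSurface {A B : ℝ → ℝ} (hA : Differentiable ℝ A) (hB : Differentiable ℝ B)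
    (u t : ℝ) :
    ∃ κ : ℝ, 0 ≤ κ ∧ (0 < Real.cos (2 * Real.pi * u) → 0 < κ) ∧
      tripleProduct (loopSurface A B u t) (deriv (fun s => loopSurface A B s t) u)
        (deriv (fun r => loopSurface A B u r) t) = κ * (A t * deriv B t - B t * deriv A t) := by
  set c := Real.cos (2 * Real.pi * u) with hc
  set s := Real.sin (2 * Real.pi * u) with hs
  set T := Real.smoothTransition with hT
  have hlin : HasDerivAt (fun u : ℝ => 2 * Real.pi * u) (2 * Real.pi) u := by
    simpa using (hasDerivAt_id u).const_mul (2 * Real.pi)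
  have hcd : HasDerivAt (fun u : ℝ => Real.cos (2 * Real.pi * u)) (-s * (2 * Real.pi)) u := hlin.cos
  have hsd : HasDerivAt (fun u : ℝ => Real.sin (2 * Real.pi * u)) (c * (2 * Real.pi)) u := hlin.sin
  have h1 : HasDerivAt (fun u : ℝ => T (Real.cos (2 * Real.pi * u)))
      (deriv T c * (-s * (2 * Real.pi))) u := (hasDerivAt_smoothTransition _).comp u hcd
  have h2 : HasDerivAt (fun u : ℝ => T (-Real.cos (2 * Real.pi * u)))
      (deriv T (-c) * -(-s * (2 * Real.pi))) u := (hasDerivAt_smoothTransition _).comp u hcd.neg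
  have du : deriv (fun s => loopSurface A B s t) u = _ :=
    (HasDerivAt.prodMk ((((h1.mul_const (A t)).sub h2).ofReal_comp).add
      (hsd.ofReal_comp.mul_const Complex.I)) (h1.mul_const (B t))).deriv
  have dt : deriv (fun r => loopSurface A B u r) t = _ :=
    (HasDerivAt.prodMk
      (((((hA t).hasDerivAt.const_mul (T c)).sub_const (T (-c))).ofReal_comp).add_const
        ((s : ℝ) * Complex.I)) ((hB t).hasDerivAt.const_mul (T c))).deriv
  refine ⟨T c * (2 * Real.pi) * (T c * c + s ^ 2 * deriv T c), ?_, fun hpos => ?_, ?_⟩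
  · rcases le_or_gt c 0 with h | h
    · simp [hT, Real.smoothTransition.zero_of_nonpos h]
    · have := Real.smoothTransition.nonneg c
      have := deriv_smoothTransition_nonneg c
      have := Real.pi_pos
      positivity
  · have h3 := Real.smoothTransition.pos_of_pos hpos
    have := deriv_smoothTransition_nonneg c
    have := Real.pi_pos
    positivity
  · rw [du, dt]
    simp only [loopSurface, ← hT, ← hc, ← hs, tripleProduct]
    rcases le_or_gt c 0 with h | h
    · have : T c = 0 := Real.smoothTransition.zero_of_nonpos h
      simp [this]
    · have e1 : T (-c) = 0 := Real.smoothTransition.zero_of_nonpos (by linarith)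
      have e2 : deriv T (-c) = 0 := deriv_smoothTransition_of_nonpos (by linarith)
      simp [e1, e2]
      ring

/-- The surface of a loop that turns clockwise around the origin has nonzero degree: its solid angle
form has a constant sign. -/
theorem solidAngle_loopSurface_ne_zero {A B : ℝ → ℝ} (hA : ContDiff ℝ ∞ A) (hB : ContDiff ℝ ∞ B)
    (h0 : ∀ u t, loopSurface A B u t ≠ 0) (hle : ∀ t, A t * deriv B t - B t * deriv A t ≤ 0)
    {t₀ : ℝ} (ht₀ : t₀ ∈ Set.Ioo (0 : ℝ) 1) (hlt : A t₀ * deriv B t₀ - B t₀ * deriv A t₀ < 0) :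
    solidAngle (loopSurface A B) ≠ 0 := by
  have dA : Differentiable ℝ A := hA.differentiable (by simp)
  have dB : Differentiable ℝ B := hB.differentiable (by simp)
  set Ω : (Fin 2 → ℝ) → ℝ := fun x => solidAngleForm (loopSurface A B (x 0) (x 1))
    (deriv (fun s => loopSurface A B s (x 1)) (x 0))
    (deriv (fun t => loopSurface A B (x 0) t) (x 1)) with hΩ
  have hg := contDiff_loopSurface hA hB
  have hcont : Continuous Ω := by
    have hd : Differentiable ℝ fun q : ℝ × ℝ => loopSurface A B q.1 q.2 :=
      hg.differentiable (by simp)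
    have hx : ContDiff ℝ ∞ fun x : Fin 2 → ℝ => (x 0, x 1) :=
      (contDiff_apply ℝ ℝ 0).prodMk (contDiff_apply ℝ ℝ 1)
    have hf := (hg.fderiv_right (m := ∞) (by simp)).comp hx
    have e1 : ∀ x : Fin 2 → ℝ, deriv (fun s => loopSurface A B s (x 1)) (x 0) =
        fderiv ℝ (fun q : ℝ × ℝ => loopSurface A B q.1 q.2) (x 0, x 1) (1, 0) := fun x =>
      (HasFDerivAt.comp_hasDerivAt (f := fun s => (s, x 1)) (x 0) (hd (x 0, x 1)).hasFDerivAt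
        ((hasDerivAt_id (x 0)).prodMk (hasDerivAt_const (x 0) (x 1)))).deriv
    have e2 : ∀ x : Fin 2 → ℝ, deriv (fun t => loopSurface A B (x 0) t) (x 1) =
        fderiv ℝ (fun q : ℝ × ℝ => loopSurface A B q.1 q.2) (x 0, x 1) (0, 1) := fun x =>
      (HasFDerivAt.comp_hasDerivAt (f := fun t => (x 0, t)) (x 1) (hd (x 0, x 1)).hasFDerivAt
        ((hasDerivAt_const (x 1) (x 0)).prodMk (hasDerivAt_id (x 1)))).deriv
    simp only [hΩ, e1, e2]
    exact continuous_iff_continuousAt.2 fun x =>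
      (contDiffAt_solidAngleForm (hg.comp hx).contDiffAt (hf.clm_apply contDiff_const).contDiffAt
        (hf.clm_apply contDiff_const).contDiffAt (h0 _ _)).continuousAt
  have hsign : ∀ x, Ω x ≤ 0 := by
    intro x
    obtain ⟨κ, hκ, -, h⟩ := tripleProduct_loopSurface dA dB (x 0) (x 1)
    simp only [hΩ, solidAngleForm, h]
    exact div_nonpos_of_nonpos_of_nonneg (mul_nonpos_of_nonneg_of_nonpos hκ (hle _)) (by positivity)
  have hx₀ : Ω ![1 / 8, t₀] < 0 := by
    obtain ⟨κ, -, hκ, h⟩ := tripleProduct_loopSurface dA dB (1 / 8) t₀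
    have hc : 0 < Real.cos (2 * Real.pi * (1 / 8)) := by
      apply Real.cos_pos_of_mem_Ioo
      constructor <;> linarith [Real.pi_pos]
    have := sqNorm_pos (h0 (1 / 8) t₀)
    simp only [hΩ, solidAngleForm, Matrix.cons_val_zero, Matrix.cons_val_one, h]
    exact div_neg_of_neg_of_pos (mul_neg_of_pos_of_neg (hκ hc) hlt) (by positivity)
  have hint : MeasureTheory.IntegrableOn (fun x => -Ω x) (Set.Icc (0 : Fin 2 → ℝ) 1) :=
    (hcont.neg.continuousOn).integrableOn_compact isCompact_Icc
  have hpos : 0 < ∫ x in Set.Icc (0 : Fin 2 → ℝ) 1, -Ω x := by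
    rw [MeasureTheory.setIntegral_pos_iff_support_of_nonneg_ae
      (Filter.Eventually.of_forall fun x => neg_nonneg.2 (hsign x)) hint]
    have hopen : IsOpen ((fun x => -Ω x) ⁻¹' Set.Ioi 0 ∩
        Set.pi Set.univ fun _ : Fin 2 => Set.Ioo (0 : ℝ) 1) :=
      (isOpen_Ioi.preimage hcont.neg).inter
        (isOpen_set_pi Set.finite_univ fun _ _ => isOpen_Ioo)
    refine (hopen.measure_pos MeasureTheory.volume ⟨![1 / 8, t₀], ?_, ?_⟩).trans_le
      (MeasureTheory.measure_mono ?_)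
    · simpa using hx₀
    · intro i _
      fin_cases i
      · norm_num
      · simpa using ht₀
    · rintro x ⟨h1, h2⟩
      exact ⟨(Set.mem_Ioi.1 h1).ne', fun i => (h2 i trivial).1.le, fun i => (h2 i trivial).2.le⟩
  rw [MeasureTheory.integral_neg] at hpos
  exact (neg_pos.1 hpos).ne

/-- Two closed braid strands are linked if the vector from one to the other, seen in the rotating
half plane through the axis, is never opposite to a loop that turns clockwise. -/
theorem linkingAngle_ne_zero_of_loop {a b : ℝ → ℂ × ℝ} {ra ha rb hb A B : ℝ → ℝ}
    (haeq : ∀ s, a s = (ra s * turn s, ha s)) (hbeq : ∀ s, b s = (rb s * turn s, hb s))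
    (cra : ContDiff ℝ ∞ ra) (cha : ContDiff ℝ ∞ ha) (crb : ContDiff ℝ ∞ rb) (chb : ContDiff ℝ ∞ hb)
    (cA : ContDiff ℝ ∞ A) (cB : ContDiff ℝ ∞ B)
    (pra : Function.Periodic ra 1) (pha : Function.Periodic ha 1)
    (prb : Function.Periodic rb 1) (phb : Function.Periodic hb 1)
    (pA : Function.Periodic A 1) (pB : Function.Periodic B 1)
    (ra0 : ∀ s, 0 < ra s) (rb0 : ∀ s, 0 < rb s)
    (hopp : ∀ t, 0 < A t * (ra t - rb t) ∨ 0 < B t * (ha t - hb t))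
    (hle : ∀ t, A t * deriv B t - B t * deriv A t ≤ 0)
    {t₀ : ℝ} (ht₀ : t₀ ∈ Set.Ioo (0 : ℝ) 1) (hlt : A t₀ * deriv B t₀ - B t₀ * deriv A t₀ < 0) :
    linkingAngle a b ≠ 0 := by
  -- The linear homotopy.  Its imaginary part vanishes only if `sin (2π u) = 0`: for integers `u`,
  -- the real part and the height move from the given vector to `(A, B)`, and halfway between integers
  -- the real part stays negative.
  set H : ℝ → ℝ → ℝ → ℂ × ℝ := fun τ u t =>
    (((1 - Real.smoothTransition τ : ℝ) : ℂ) * (ra (u + t) * turn u - rb t) +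
        ((Real.smoothTransition τ : ℝ) : ℂ) * (loopSurface A B u t).1,
      (1 - Real.smoothTransition τ) * (ha (u + t) - hb t) +
        Real.smoothTransition τ * (loopSurface A B u t).2) with hH
  have hH0 : ∀ τ u t, H τ u t ≠ 0 := by
    intro τ u t h
    have hT0 := Real.smoothTransition.nonneg τ
    have hT1 := Real.smoothTransition.le_one τ
    simp only [hH, Prod.mk_eq_zero] at h
    generalize Real.smoothTransition τ = θ at *
    obtain ⟨h1, h2⟩ := h
    have him := congrArg Complex.im h1
    have hre := congrArg Complex.re h1
    simp only [loopSurface, Complex.add_im, Complex.add_re, Complex.re_ofReal_mul,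
      Complex.im_ofReal_mul, Complex.sub_re, Complex.sub_im, Complex.ofReal_re, Complex.ofReal_im,
      Complex.I_re, Complex.I_im, turn_re, turn_im, Complex.zero_im, Complex.zero_re] at him hre
    have hsin : Real.sin (2 * Real.pi * u) = 0 := by
      have h3 : ((1 - θ) * ra (u + t) + θ) * Real.sin (2 * Real.pi * u) = 0 := by linarith
      rcases mul_eq_zero.1 h3 with h4 | h4
      · exfalso
        have := ra0 (u + t)
        rcases hT0.eq_or_lt with h5 | h5
        · rw [← h5] at h4
          linarith
        · nlinarith
      · exact h4
    rcases Real.sin_eq_zero_iff_cos_eq.1 hsin with hcos | hcos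
    · obtain ⟨n, hn⟩ := (Real.cos_eq_one_iff _).1 hcos
      have hun : u = n := by
        have := Real.pi_pos
        have : 2 * Real.pi * (u - n) = 0 := by linarith
        rcases mul_eq_zero.1 this with h | h
        · linarith
        · linarith
      have e1 : ra (u + t) = ra t := by
        rw [hun, add_comm]; simpa using pra.int_mul n t
      have e2 : ha (u + t) = ha t := by
        rw [hun, add_comm]; simpa using pha.int_mul n t
      have T1 : Real.smoothTransition (-1) = 0 :=
        Real.smoothTransition.zero_of_nonpos (by norm_num)
      simp only [loopSurface, hcos, hsin, e1, e2, T1, Real.smoothTransition.one] at hre h2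
      have h3 : (1 - θ) * (ra t - rb t) + θ * A t = 0 := by linarith
      have h4 : (1 - θ) * (ha t - hb t) + θ * B t = 0 := by linarith
      have opp : ∀ x y : ℝ, 0 < x * y → (1 - θ) * y + θ * x ≠ 0 := by
        intro x y hxy h
        have h5 : (1 - θ) * (x * y) + θ * x ^ 2 = 0 := by linear_combination x * h
        have hx : 0 < x ^ 2 := by
          have : x ≠ 0 := by rintro rfl; simp at hxy
          positivity
        rcases hT0.eq_or_lt with h6 | h6
        · rw [← h6] at h5
          linarith
        · nlinarith [mul_nonneg (sub_nonneg.2 hT1) hxy.le, mul_pos h6 hx]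
      rcases hopp t with h | h
      · exact opp _ _ h h3
      · exact opp _ _ h h4
    · have T1 : Real.smoothTransition (-1) = 0 :=
        Real.smoothTransition.zero_of_nonpos (by norm_num)
      simp only [hcos, hsin, T1, neg_neg, Real.smoothTransition.one] at hre
      have := ra0 (u + t)
      have := rb0 t
      rcases hT0.eq_or_lt with h5 | h5
      · rw [← h5] at hre
        linarith
      · nlinarith
  have h := solidAngle_eq_of_homotopy (H := H) ?_ ?_ ?_ fun τ _ => hH0 τ
  · have e0 : H 0 = twistedDifference a b := by
      funext u t
      have : turn (-t) * (ra (u + t) * turn (u + t) - rb t * turn t) =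
          ra (u + t) * turn u - rb t := by
        have h1 : turn (-t) * turn t = 1 := by rw [← turn_add]; simp [turn_zero]
        rw [turn_add]
        linear_combination (ra (u + t) * turn u - rb t) * h1
      simp [hH, twistedDifference, haeq, hbeq, this]
    have e1 : H 1 = loopSurface A B := by
      funext u t
      simp [hH]
    rw [linkingAngle, ← e0, h, e1]
    refine solidAngle_loopSurface_ne_zero cA cB (fun u t => ?_) hle ht₀ hlt
    rw [← e1]
    exact hH0 1 u t
  · have hT : ContDiff ℝ ∞ fun q : ℝ × ℝ × ℝ => Real.smoothTransition q.1 :=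
      Real.smoothTransition.contDiff.comp contDiff_fst
    have hT' : ContDiff ℝ ∞ fun q : ℝ × ℝ × ℝ => 1 - Real.smoothTransition q.1 :=
      contDiff_const.sub hT
    have hS := (contDiff_loopSurface cA cB).comp
      (contDiff_snd : ContDiff ℝ ∞ (Prod.snd : ℝ × ℝ × ℝ → ℝ × ℝ))
    have hadd : ContDiff ℝ ∞ fun q : ℝ × ℝ × ℝ => q.2.1 + q.2.2 :=
      contDiff_snd.fst.add contDiff_snd.snd
    have ofR : ∀ {f : ℝ × ℝ × ℝ → ℝ}, ContDiff ℝ ∞ f → ContDiff ℝ ∞ fun q => (f q : ℂ) :=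
      fun hf => Complex.ofRealCLM.contDiff.comp hf
    exact (((ofR hT').mul (((ofR (cra.comp hadd)).mul (contDiff_turn.comp contDiff_snd.fst)).sub
      (ofR (crb.comp contDiff_snd.snd)))).add ((ofR hT).mul hS.fst)).prodMk
      ((hT'.mul ((cha.comp hadd).sub (chb.comp contDiff_snd.snd))).add (hT.mul hS.snd))
  · intro τ u t
    have h1 : Real.cos (2 * Real.pi * (u + 1)) = Real.cos (2 * Real.pi * u) := by
      rw [← turn_re, turn_add_one, turn_re]
    have h2 : Real.sin (2 * Real.pi * (u + 1)) = Real.sin (2 * Real.pi * u) := by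
      rw [← turn_im, turn_add_one, turn_im]
    simp only [hH, loopSurface, add_right_comm u 1 t, pra _, pha _, turn_add_one, h1, h2]
  · intro τ u t
    simp only [hH, loopSurface, ← add_assoc, pra _, pha _, prb _, phb _, pA _, pB _]

/-! ### Strands of a braid word -/

theorem smoothTransition_one_sub (x : ℝ) :
    Real.smoothTransition (1 - x) = 1 - Real.smoothTransition x := by
  have := Real.smoothTransition.pos_denom x
  rw [Real.smoothTransition, Real.smoothTransition, sub_sub_cancel, add_comm, eq_sub_iff_add_eq,
    ← add_div, add_comm (expNegInvGlue (1 - x)), div_self this.ne']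

theorem eq_half_of_smoothTransition_eq_half {x : ℝ} (h : Real.smoothTransition x = 1 / 2) :
    x = 1 / 2 := by
  have h0 : 0 < x := by
    by_contra hx
    rw [Real.smoothTransition.zero_of_nonpos (not_lt.1 hx)] at h
    norm_num at h
  have h1 : x < 1 := by
    by_contra hx
    rw [Real.smoothTransition.one_of_one_le (not_lt.1 hx)] at h
    norm_num at h
  rw [Real.smoothTransition, div_eq_iff (Real.smoothTransition.pos_denom x).ne'] at h
  have h2 : expNegInvGlue x = expNegInvGlue (1 - x) := by linarith
  rw [expNegInvGlue, expNegInvGlue, if_neg (by linarith), if_neg (by linarith),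
    Real.exp_eq_exp, neg_inj, inv_inj] at h2
  linarith

theorem smoothTransition_half : Real.smoothTransition (1 / 2) = 1 / 2 := by
  have h := smoothTransition_one_sub (1 / 2)
  norm_num at h ⊢
  linarith

theorem deriv_smoothTransition_half_pos : 0 < deriv Real.smoothTransition (1 / 2) := by
  have hd : HasDerivAt expNegInvGlue (Real.exp (-2) * 4) (1 / 2) := by
    have h1 : HasDerivAt (fun x : ℝ => Real.exp (-x⁻¹)) (Real.exp (-2) * 4) (1 / 2) := by
      refine ((hasDerivAt_inv (by norm_num : (1 / 2 : ℝ) ≠ 0)).neg.exp).congr_deriv ?_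
      norm_num
    refine h1.congr_of_eventuallyEq ?_
    filter_upwards [lt_mem_nhds (by norm_num : (0 : ℝ) < 1 / 2)] with y hy
    simp [expNegInvGlue, hy.not_ge]
  have hd' : HasDerivAt (fun x => expNegInvGlue (1 - x)) (-(Real.exp (-2) * 4)) (1 / 2) := by
    have h1 : HasDerivAt (fun x : ℝ => 1 - x) (-1) (1 / 2) := by
      simpa using (hasDerivAt_id (1 / 2 : ℝ)).const_sub 1
    have h2 : HasDerivAt expNegInvGlue (Real.exp (-2) * 4) (1 - 1 / 2) := by norm_num; exact hd
    exact (HasDerivAt.comp (1 / 2 : ℝ) h2 h1).congr_deriv (by ring)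
  have hT : HasDerivAt Real.smoothTransition _ (1 / 2) :=
    hd.div (hd.add hd') (Real.smoothTransition.pos_denom _).ne'
  rw [hT.deriv]
  have he : 0 < expNegInvGlue (1 / 2) := expNegInvGlue.pos_of_pos (by norm_num)
  have : (1 - 1 / 2 : ℝ) = 1 / 2 := by norm_num
  simp only [this, add_neg_cancel, mul_zero, sub_zero]
  positivity

section Word
variable {n : ℕ} (w : BraidWord n)

theorem braidPerm_append (v w : BraidWord n) : braidPerm (v ++ w) = braidPerm w * braidPerm v := by
  induction v with
  | nil => simp [braidPerm]
  | cons l v ih => simp [braidPerm, ih, mul_assoc]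

theorem strandPos_zero (x : Fin n) : strandPos w x 0 = x := by simp [strandPos, braidPerm]

theorem strandPos_length (x : Fin n) : strandPos w x w.length = braidPerm w x := by
  simp [strandPos]

theorem strandPos_succ (x : Fin n) (k : Fin w.length) :
    strandPos w x (k + 1) =
      Equiv.swap (lowPos (w.get k).1) (highPos (w.get k).1) (strandPos w x k) := by
  rw [strandPos, ← List.take_append_getElem k.isLt, braidPerm_append]
  simp [braidPerm, strandPos]

theorem strandPos_injective (k : ℕ) : Function.Injective fun x => strandPos w x k :=
  (braidPerm (w.take k)).injective

theorem lowPos_ne_highPos (i : Fin (n - 1)) : lowPos i ≠ highPos i := by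
  simp [lowPos, highPos]

/-- The letter number `k` (from `0`) is a crossing of the strands that start in the positions `x`
and `y`, where `x` arrives in the lower position. -/
def CrossAt (k : Fin w.length) (x y : Fin n) : Prop :=
  strandPos w x k = lowPos (w.get k).1 ∧ strandPos w y k = highPos (w.get k).1

variable {w}

theorem CrossAt.ne {k : Fin w.length} {x y : Fin n} (h : CrossAt w k x y) : x ≠ y := by
  rintro rfl
  exact lowPos_ne_highPos _ (h.1.symm.trans h.2)

theorem CrossAt.strandPos_succ_left {k : Fin w.length} {x y : Fin n} (h : CrossAt w k x y) :
    strandPos w x (k + 1) = highPos (w.get k).1 := by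
  rw [strandPos_succ, h.1, Equiv.swap_apply_left]

theorem CrossAt.strandPos_succ_right {k : Fin w.length} {x y : Fin n} (h : CrossAt w k x y) :
    strandPos w y (k + 1) = lowPos (w.get k).1 := by
  rw [strandPos_succ, h.2, Equiv.swap_apply_right]

/-- Strands that exchange their order in a letter are the two strands that cross there, since the
letter only exchanges two adjacent positions. -/
theorem crossAt_of_strandPos_lt {k : Fin w.length} {x y : Fin n}
    (h1 : strandPos w x k < strandPos w y k)
    (h2 : strandPos w y (k + 1) < strandPos w x (k + 1)) : CrossAt w k x y := by
  rw [strandPos_succ, strandPos_succ] at h2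
  simp only [CrossAt]
  generalize strandPos w x k = a at *
  generalize strandPos w y k = b at *
  rw [Equiv.swap_apply_def, Equiv.swap_apply_def] at h2
  simp only [lowPos, highPos, Fin.ext_iff, Fin.lt_def] at *
  split_ifs at h2 <;> (try simp only at h2) <;> omega

variable (w)

theorem contDiff_strandRadius (x : Fin n) : ContDiff ℝ ∞ (strandRadius w x) :=
  contDiff_const.add (ContDiff.sum fun _ _ =>
    contDiff_const.mul (Real.smoothTransition.contDiff.comp (contDiff_id.sub contDiff_const)))

theorem contDiff_strandHeight (x : Fin n) : ContDiff ℝ ∞ (strandHeight w x) := by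
  refine ContDiff.sum fun k _ => ?_
  split_ifs
  · exact (Real.smoothTransition.contDiff.comp (contDiff_id.sub contDiff_const)).mul
      (Real.smoothTransition.contDiff.comp (contDiff_const.sub (contDiff_id.sub contDiff_const)))
  · exact contDiff_const

theorem strandRadius_of_mem (x : Fin n) (k : Fin w.length) {u : ℝ} (h1 : k ≤ u) (h2 : u ≤ k + 1) :
    strandRadius w x u = 1 + (strandPos w x k : ℕ) +
      ((strandPos w x (k + 1) : ℕ) - (strandPos w x k : ℕ)) * Real.smoothTransition (u - k) := by
  set f : ℕ → ℝ := fun j => (((strandPos w x (j + 1) : ℕ) : ℝ) - ((strandPos w x j : ℕ) : ℝ)) *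
      Real.smoothTransition (u - j) with hf
  have e1 : ∑ j : Fin w.length, f j = ∑ j ∈ Finset.range (k + 1), f j := by
    rw [Fin.sum_univ_eq_sum_range]
    refine (Finset.sum_subset (Finset.range_mono k.isLt) fun j _ hj => ?_).symm
    have hj' : (k : ℝ) + 1 ≤ j := by
      have : (k : ℕ) + 1 ≤ j := by simpa using hj
      exact_mod_cast this
    simp only [hf]
    rw [Real.smoothTransition.zero_of_nonpos (by linarith), mul_zero]
  have e2 : ∑ j ∈ Finset.range k, f j =
      ((strandPos w x k : ℕ) : ℝ) - ((strandPos w x 0 : ℕ) : ℝ) := by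
    rw [← Finset.sum_range_sub fun j => ((strandPos w x j : ℕ) : ℝ)]
    refine Finset.sum_congr rfl fun j hj => ?_
    have hj' : (j : ℝ) + 1 ≤ k := by
      have : j + 1 ≤ (k : ℕ) := Finset.mem_range.1 hj
      exact_mod_cast this
    simp only [hf]
    rw [Real.smoothTransition.one_of_one_le (by linarith), mul_one]
  have e3 : strandRadius w x u = 1 + (x : ℝ) + ∑ j : Fin w.length, f j := rfl
  rw [e3, e1, Finset.sum_range_succ, e2, strandPos_zero]
  simp only [hf]
  ring

theorem strandRadius_of_nonpos (x : Fin n) {u : ℝ} (hu : u ≤ 0) :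
    strandRadius w x u = 1 + (x : ℕ) := by
  rw [strandRadius, Finset.sum_eq_zero, add_zero]
  intro k _
  have : (0 : ℝ) ≤ (k : ℕ) := Nat.cast_nonneg _
  rw [Real.smoothTransition.zero_of_nonpos (by linarith), mul_zero]

theorem strandRadius_of_length_le (x : Fin n) {u : ℝ} (hu : w.length ≤ u) :
    strandRadius w x u = 1 + (braidPerm w x : ℕ) := by
  have h : ∀ k : Fin w.length, (((strandPos w x (k + 1) : ℕ) : ℝ) - ((strandPos w x k : ℕ) : ℝ)) *
      Real.smoothTransition (u - (k : ℕ)) =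
      (((strandPos w x (k + 1) : ℕ) : ℝ) - ((strandPos w x k : ℕ) : ℝ)) := by
    intro k
    have : ((k : ℕ) : ℝ) + 1 ≤ w.length := by exact_mod_cast k.isLt
    rw [Real.smoothTransition.one_of_one_le (by linarith), mul_one]
  rw [strandRadius, Finset.sum_congr rfl fun k _ => h k,
    Fin.sum_univ_eq_sum_range
      (fun k => (((strandPos w x (k + 1) : ℕ) : ℝ) - ((strandPos w x k : ℕ) : ℝ))),
    Finset.sum_range_sub fun j => ((strandPos w x j : ℕ) : ℝ), strandPos_zero, strandPos_length]
  ring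

theorem lift_eq_zero {k : ℕ} {u : ℝ} (h : u ≤ k ∨ k + 1 ≤ u) :
    Real.smoothTransition (u - k) * Real.smoothTransition (1 - (u - k)) = 0 := by
  rcases h with h | h
  · rw [Real.smoothTransition.zero_of_nonpos (x := u - k) (by linarith), zero_mul]
  · rw [Real.smoothTransition.zero_of_nonpos (x := 1 - (u - k)) (by linarith), mul_zero]

open Classical in
theorem strandHeight_of_mem (x : Fin n) (k : Fin w.length) {u : ℝ} (h1 : k ≤ u) (h2 : u ≤ k + 1) :
    strandHeight w x u = if IsOver (w.get k) (strandPos w x k) then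
      Real.smoothTransition (u - k) * (1 - Real.smoothTransition (u - k)) else 0 := by
  rw [strandHeight, Finset.sum_eq_single k, smoothTransition_one_sub]
  · intro j _ hj
    rw [lift_eq_zero, ite_self]
    rcases lt_or_gt_of_ne (fun h => hj (Fin.ext h) : (j : ℕ) ≠ k) with h | h
    · right
      have : ((j : ℕ) : ℝ) + 1 ≤ (k : ℕ) := by exact_mod_cast h
      linarith
    · left
      have : ((k : ℕ) : ℝ) + 1 ≤ (j : ℕ) := by exact_mod_cast h
      linarith
  · simp

theorem strandHeight_of_nonpos (x : Fin n) {u : ℝ} (hu : u ≤ 0) : strandHeight w x u = 0 := by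
  refine Finset.sum_eq_zero fun k _ => ?_
  have : (0 : ℝ) ≤ (k : ℕ) := Nat.cast_nonneg _
  rw [lift_eq_zero (Or.inl (by linarith)), ite_self]

theorem strandHeight_of_length_le (x : Fin n) {u : ℝ} (hu : w.length ≤ u) :
    strandHeight w x u = 0 := by
  refine Finset.sum_eq_zero fun k _ => ?_
  have : ((k : ℕ) : ℝ) + 1 ≤ w.length := by exact_mod_cast k.isLt
  rw [lift_eq_zero (Or.inr (by linarith)), ite_self]

theorem exists_letter_or_length_le {m : ℕ} {u : ℝ} (hu : 0 ≤ u) :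
    (∃ k : Fin m, (k : ℝ) ≤ u ∧ u < k + 1) ∨ (m : ℝ) ≤ u := by
  by_cases h : ⌊u⌋₊ < m
  · exact Or.inl ⟨⟨_, h⟩, Nat.floor_le hu, Nat.lt_floor_add_one u⟩
  · exact Or.inr ((Nat.cast_le.2 (not_lt.1 h)).trans (Nat.floor_le hu))

theorem strandRadius_pos (x : Fin n) {u : ℝ} (hu : 0 ≤ u) : 0 < strandRadius w x u := by
  rcases exists_letter_or_length_le (m := w.length) hu with ⟨k, h1, h2⟩ | h
  · rw [strandRadius_of_mem w x k h1 h2.le]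
    have h3 : (0 : ℝ) ≤ (strandPos w x k : ℕ) := Nat.cast_nonneg _
    have h4 : (0 : ℝ) ≤ (strandPos w x (k + 1) : ℕ) := Nat.cast_nonneg _
    nlinarith [mul_nonneg h3 (sub_nonneg.2 (Real.smoothTransition.le_one (u - k))),
      mul_nonneg h4 (Real.smoothTransition.nonneg (u - k))]
  · rw [strandRadius_of_length_le w x h]
    positivity

theorem strandHeight_mem_Icc (x : Fin n) {u : ℝ} (hu : 0 ≤ u) :
    strandHeight w x u ∈ Set.Icc (0 : ℝ) 1 := by
  rcases exists_letter_or_length_le (m := w.length) hu with ⟨k, h1, h2⟩ | h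
  · rw [strandHeight_of_mem w x k h1 h2.le]
    have h3 := Real.smoothTransition.nonneg (u - k)
    have h4 := Real.smoothTransition.le_one (u - k)
    split_ifs
    · constructor <;> nlinarith
    · simp
  · simp [strandHeight_of_length_le w x h]

variable {w}

theorem strandRadius_lt {x y : Fin n} {k : Fin w.length} (h : strandPos w x k < strandPos w y k)
    (h' : strandPos w x (k + 1) < strandPos w y (k + 1)) {u : ℝ} (h1 : k ≤ u) (h2 : u ≤ k + 1) :
    strandRadius w x u < strandRadius w y u := by
  rw [strandRadius_of_mem w x k h1 h2, strandRadius_of_mem w y k h1 h2]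
  have h3 : ((strandPos w x k : ℕ) : ℝ) + 1 ≤ (strandPos w y k : ℕ) := by exact_mod_cast h
  have h4 : ((strandPos w x (k + 1) : ℕ) : ℝ) + 1 ≤ (strandPos w y (k + 1) : ℕ) := by
    exact_mod_cast h'
  nlinarith [mul_nonneg (Real.smoothTransition.nonneg (u - k)) (sub_nonneg.2 h4),
    mul_nonneg (sub_nonneg.2 (Real.smoothTransition.le_one (u - k))) (sub_nonneg.2 h3)]

/-- Strands meet only in the middle of the letters at which they cross. -/
theorem exists_crossAt_of_strandRadius_eq (hw : braidPerm w = 1) {x y : Fin n} (hxy : x ≠ y) {u : ℝ}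
    (hu : 0 ≤ u) (h : strandRadius w x u = strandRadius w y u) :
    ∃ k : Fin w.length, u = k + 1 / 2 ∧ (CrossAt w k x y ∨ CrossAt w k y x) := by
  rcases exists_letter_or_length_le (m := w.length) hu with ⟨k, h1, h2⟩ | h'
  · have n1 : strandPos w x k ≠ strandPos w y k := fun e => hxy (strandPos_injective w _ e)
    have n2 : strandPos w x (k + 1) ≠ strandPos w y (k + 1) :=
      fun e => hxy (strandPos_injective w _ e)
    have cross : CrossAt w k x y ∨ CrossAt w k y x := by
      rcases lt_or_gt_of_ne n1 with a | a <;> rcases lt_or_gt_of_ne n2 with b | b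
      · exact absurd h (strandRadius_lt a b h1 h2.le).ne
      · exact Or.inl (crossAt_of_strandPos_lt a b)
      · exact Or.inr (crossAt_of_strandPos_lt a b)
      · exact absurd h (strandRadius_lt a b h1 h2.le).ne'
    refine ⟨k, ?_, cross⟩
    have half : Real.smoothTransition (u - k) = 1 / 2 := by
      rw [strandRadius_of_mem w x k h1 h2.le, strandRadius_of_mem w y k h1 h2.le] at h
      rcases cross with c | c <;>
      · rw [c.1, c.2, c.strandPos_succ_left, c.strandPos_succ_right] at h
        simp only [lowPos, highPos] at h
        push_cast at h
        linarith
    linarith [eq_half_of_smoothTransition_eq_half half]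
  · rw [strandRadius_of_length_le w x h', strandRadius_of_length_le w y h', hw] at h
    exact absurd (Fin.ext (by exact_mod_cast add_left_cancel h)) hxy

theorem CrossAt.strandHeight_left {k : Fin w.length} {x y : Fin n} (h : CrossAt w k x y) {u : ℝ}
    (h1 : k ≤ u) (h2 : u ≤ k + 1) : strandHeight w x u = if (w.get k).2 then
      Real.smoothTransition (u - k) * (1 - Real.smoothTransition (u - k)) else 0 := by
  rw [strandHeight_of_mem w x k h1 h2, h.1]
  cases h3 : (w.get k).2 <;> simp [IsOver, -List.get_eq_getElem, h3, lowPos_ne_highPos]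

theorem CrossAt.strandHeight_right {k : Fin w.length} {x y : Fin n} (h : CrossAt w k x y) {u : ℝ}
    (h1 : k ≤ u) (h2 : u ≤ k + 1) : strandHeight w y u = if (w.get k).2 then 0 else
      Real.smoothTransition (u - k) * (1 - Real.smoothTransition (u - k)) := by
  rw [strandHeight_of_mem w y k h1 h2, h.2]
  cases h3 : (w.get k).2 <;> simp [IsOver, -List.get_eq_getElem, h3, (lowPos_ne_highPos _).symm]

theorem CrossAt.strandRadius_left {k : Fin w.length} {x y : Fin n} (h : CrossAt w k x y) {u : ℝ}
    (h1 : k ≤ u) (h2 : u ≤ k + 1) :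
    strandRadius w x u = 1 + ((w.get k).1 : ℕ) + Real.smoothTransition (u - k) := by
  rw [strandRadius_of_mem w x k h1 h2, h.strandPos_succ_left, h.1]
  simp only [lowPos, highPos]
  push_cast
  ring

theorem CrossAt.strandRadius_right {k : Fin w.length} {x y : Fin n} (h : CrossAt w k x y) {u : ℝ}
    (h1 : k ≤ u) (h2 : u ≤ k + 1) :
    strandRadius w y u = 2 + ((w.get k).1 : ℕ) - Real.smoothTransition (u - k) := by
  rw [strandRadius_of_mem w y k h1 h2, h.strandPos_succ_right, h.2]
  simp only [lowPos, highPos]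
  push_cast
  ring

end Word

theorem periodic_fract_mul (f : ℝ → ℝ) (m : ℝ) :
    Function.Periodic (fun v : ℝ => f (Int.fract v * m)) 1 := fun v => by
  simp [Int.fract_add_one]

/-- Near the beginning of the turn number `n`, the constant values of `f` make up for the jump of
`Int.fract`. -/
theorem fract_mul_eq {f : ℝ → ℝ} {c : ℝ} {m : ℕ} (h0 : ∀ u ≤ 0, f u = c)
    (h1 : ∀ u, (m : ℝ) ≤ u → f u = c) {n : ℤ} {v : ℝ} (hv : n - 1 / (m + 1 : ℝ) < v)
    (hv' : v < n + 1) : f (Int.fract v * (m + 1)) = f ((v - n) * (m + 1)) := by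
  have hm : (0 : ℝ) < m + 1 := by positivity
  rcases le_or_gt (n : ℝ) v with h | h
  · have : ⌊v⌋ = n := Int.floor_eq_iff.2 ⟨h, hv'⟩
    rw [← Int.self_sub_floor, this]
  · have hlt : 1 / (m + 1 : ℝ) ≤ 1 := by
      rw [div_le_one hm]
      linarith [(Nat.cast_nonneg m : (0 : ℝ) ≤ m)]
    have : ⌊v⌋ = n - 1 := Int.floor_eq_iff.2 ⟨by push_cast; linarith, by push_cast; linarith⟩
    have hlen : (n - v) * (m + 1) < 1 := by
      rw [← lt_div_iff₀ hm]
      linarith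
    rw [h0 ((v - n) * (m + 1)) (by nlinarith), h1]
    rw [← Int.self_sub_floor, this]
    push_cast
    nlinarith

theorem eventually_fract_mul_eq {f : ℝ → ℝ} {c : ℝ} {m : ℕ} (h0 : ∀ u ≤ 0, f u = c)
    (h1 : ∀ u, (m : ℝ) ≤ u → f u = c) (v₀ : ℝ) :
    (fun v : ℝ => f (Int.fract v * (m + 1))) =ᶠ[nhds v₀] fun v => f ((v - ⌊v₀⌋) * (m + 1)) := by
  have hm : (0 : ℝ) < 1 / (m + 1) := by positivity
  filter_upwards [Ioo_mem_nhds (a := (⌊v₀⌋ : ℝ) - 1 / (m + 1)) (b := ⌊v₀⌋ + 1)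
    (by linarith [Int.floor_le v₀]) (Int.lt_floor_add_one v₀)] with v hv
  exact fract_mul_eq h0 h1 hv.1 hv.2

/-- A smooth function that has the same constant value before the time `0` and after the time `m`
can be repeated smoothly with period `m + 1`. -/
theorem contDiff_fract_mul {f : ℝ → ℝ} {c : ℝ} {m : ℕ} (hf : ContDiff ℝ ∞ f)
    (h0 : ∀ u ≤ 0, f u = c) (h1 : ∀ u, (m : ℝ) ≤ u → f u = c) :
    ContDiff ℝ ∞ fun v : ℝ => f (Int.fract v * (m + 1)) := by
  refine contDiff_iff_contDiffAt.2 fun v₀ => ?_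
  have hg : ContDiff ℝ ∞ fun v : ℝ => f ((v - ⌊v₀⌋) * (m + 1)) :=
    hf.comp ((contDiff_id.sub contDiff_const).mul contDiff_const)
  exact hg.contDiffAt.congr_of_eventuallyEq (eventually_fract_mul_eq h0 h1 v₀)

theorem deriv_fract_mul {f : ℝ → ℝ} {c : ℝ} {m : ℕ} (hf : Differentiable ℝ f)
    (h0 : ∀ u ≤ 0, f u = c) (h1 : ∀ u, (m : ℝ) ≤ u → f u = c) (v₀ : ℝ) :
    deriv (fun v : ℝ => f (Int.fract v * (m + 1))) v₀ =
      deriv f (Int.fract v₀ * (m + 1)) * (m + 1) := by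
  rw [(eventually_fract_mul_eq h0 h1 v₀).deriv_eq]
  have hl : HasDerivAt (fun v : ℝ => (v - ⌊v₀⌋) * (m + 1)) (m + 1) v₀ := by
    simpa using ((hasDerivAt_id v₀).sub_const (⌊v₀⌋ : ℝ)).mul_const ((m : ℝ) + 1)
  exact (HasDerivAt.comp v₀ (hf _).hasDerivAt hl).deriv

/-! ### Closures of pure braid words -/

theorem eq_of_radius_mul_turn_eq {r r' s t : ℝ} (hr : 0 < r) (hr' : 0 < r')
    (h : (r : ℂ) * turn s = r' * turn t) : r = r' ∧ ∃ k : ℤ, t = s + k := by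
  have h1 : r = r' := by
    have := congrArg norm h
    simpa [norm_turn, abs_of_pos hr, abs_of_pos hr'] using this
  refine ⟨h1, turn_eq_turn (mul_left_cancel₀ (Complex.ofReal_ne_zero.2 hr.ne') ?_)⟩
  rw [h, h1]

theorem hasDerivAt_radius_mul_turn {r : ℝ → ℝ} {r' s : ℝ} (hr : HasDerivAt r r' s) :
    HasDerivAt (fun s => (r s : ℂ) * turn s) ((r' + 2 * Real.pi * r s * Complex.I) * turn s) s :=
  (hr.ofReal_comp.mul (hasDerivAt_turn s)).congr_deriv (by ring)

theorem deriv_radius_mul_turn_ne_zero {r : ℝ → ℝ} (hr : ContDiff ℝ ∞ r) (h0 : ∀ s, 0 < r s)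
    (z : ℂ) (s : ℝ) : deriv (fun s => z + (r s : ℂ) * turn s) s ≠ 0 := by
  have hd := hasDerivAt_radius_mul_turn ((hr.differentiable (by simp)) s).hasDerivAt
  rw [(hd.const_add z).deriv]
  refine mul_ne_zero (fun h => ?_) (turn_ne_zero s)
  have := congrArg Complex.im h
  simp [Real.pi_ne_zero, (h0 s).ne'] at this

/-- Disjoint curves that run once around vertical axes form a link. -/
theorem isLink_of_radius_pos {ι : Type} {z : ι → ℂ} {r h : ι → ℝ → ℝ} (hr : ∀ i, ContDiff ℝ ∞ (r i))
    (hh : ∀ i, ContDiff ℝ ∞ (h i)) (pr : ∀ i, Function.Periodic (r i) 1)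
    (ph : ∀ i, Function.Periodic (h i) 1) (h0 : ∀ i s, 0 < r i s)
    (hdisj : ∀ i j, i ≠ j → ∀ s t, z i + r i s * turn s = z j + r j t * turn t → h i s ≠ h j t) :
    IsLink (fun i s => (z i + r i s * turn s, h i s)) where
  smooth i := (contDiff_const.add ((Complex.ofRealCLM.contDiff.comp (hr i)).mul
    contDiff_turn)).prodMk (hh i)
  periodic i s := by simp only [pr i s, ph i s, turn_add_one]
  immersion i s hs := by
    have h1 : DifferentiableAt ℝ (fun s => z i + (r i s : ℂ) * turn s) s :=
      ((contDiff_const.add ((Complex.ofRealCLM.contDiff.comp (hr i)).mul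
        contDiff_turn)).differentiable (by simp)) s
    have h2 := (h1.hasDerivAt.prodMk (((hh i).differentiable (by simp)) s).hasDerivAt).deriv
    rw [h2] at hs
    exact deriv_radius_mul_turn_ne_zero (hr i) (h0 i) (z i) s (congrArg Prod.fst hs)
  injective i s j t hst := by
    simp only [Prod.mk.injEq] at hst
    by_cases hij : i = j
    · subst hij
      exact ⟨rfl, (eq_of_radius_mul_turn_eq (h0 i s) (h0 i t) (add_left_cancel hst.1)).2⟩
    · exact absurd hst.2 (hdisj i j hij s t hst.1)

section Word
variable {n : ℕ} (w : BraidWord n)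

/-- The time in the word at which a closed braid curve is after `v` turns. -/
def wordTime (v : ℝ) : ℝ := Int.fract v * (w.length + 1)

theorem wordTime_nonneg (v : ℝ) : 0 ≤ wordTime w v :=
  mul_nonneg (Int.fract_nonneg v) (by positivity)

theorem wordTime_add_int (v : ℝ) (k : ℤ) : wordTime w (v + k) = wordTime w v := by
  simp [wordTime]

/-- The closed curve of the strand that starts in position `x`, for a pure braid word. -/
def strandCurve (x : Fin n) (v : ℝ) : ℂ × ℝ :=
  (strandRadius w x (wordTime w v) * turn v, strandHeight w x (wordTime w v))

/-- A family of strands of the closure of a pure braid word. -/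
def strandCurves {ι : Type} (x : ι → Fin n) : Curves ι := fun i => strandCurve w (x i)

variable {w}

theorem braidClosure_eq_strandCurves (hw : braidPerm w = 1) :
    braidClosure w = strandCurves w (Quotient.out : Component w → Fin n) := by
  have hx : ∀ x, braidPerm w x = x := fun x => by rw [hw]; rfl
  have hp : ∀ (k : ℤ) (x : Fin n), (braidPerm w ^ k) x = x := fun k x => by
    rw [hw, one_zpow]; rfl
  funext c s
  have h1 : Function.minimalPeriod (braidPerm w) c.out = 1 :=
    Function.minimalPeriod_eq_one_iff_isFixedPt.2 (hx _)
  simp only [braidClosure, h1, closedStrand, strandCurves, strandCurve, hp]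
  simp [turn, wordTime]

theorem out_surjective (hw : braidPerm w = 1) :
    Function.Surjective (Quotient.out : Component w → Fin n) := by
  intro x
  refine ⟨Quotient.mk _ x, ?_⟩
  obtain ⟨k, hk⟩ : (braidPerm w).SameCycle
      (Quotient.mk (Equiv.Perm.SameCycle.setoid (braidPerm w)) x).out x :=
    Quotient.exact (Quotient.out_eq (Quotient.mk (Equiv.Perm.SameCycle.setoid (braidPerm w)) x))
  have h1 : braidPerm w ^ k = 1 := by rw [hw, one_zpow]
  rw [h1] at hk
  exact hk

theorem contDiff_strandRadius_wordTime (hw : braidPerm w = 1) (x : Fin n) :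
    ContDiff ℝ ∞ fun v => strandRadius w x (wordTime w v) :=
  contDiff_fract_mul (contDiff_strandRadius w x) (fun _ hu => strandRadius_of_nonpos w x hu)
    fun u hu => by rw [strandRadius_of_length_le w x hu, hw]; rfl

theorem contDiff_strandHeight_wordTime (x : Fin n) :
    ContDiff ℝ ∞ fun v => strandHeight w x (wordTime w v) :=
  contDiff_fract_mul (contDiff_strandHeight w x) (fun _ hu => strandHeight_of_nonpos w x hu)
    fun _ hu => strandHeight_of_length_le w x hu

theorem strandRadius_wordTime_periodic (x : Fin n) :
    Function.Periodic (fun v => strandRadius w x (wordTime w v)) 1 :=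
  periodic_fract_mul _ _

theorem strandHeight_wordTime_periodic (x : Fin n) :
    Function.Periodic (fun v => strandHeight w x (wordTime w v)) 1 :=
  periodic_fract_mul _ _

theorem strandRadius_wordTime_pos (x : Fin n) (v : ℝ) : 0 < strandRadius w x (wordTime w v) :=
  strandRadius_pos w x (wordTime_nonneg w v)

/-- At a crossing, the heights of the two strands are different. -/
theorem CrossAt.strandHeight_lt {k : Fin w.length} {x y : Fin n} (h : CrossAt w k x y) :
    if (w.get k).2 then strandHeight w y (k + 1 / 2) < strandHeight w x (k + 1 / 2) else
      strandHeight w x (k + 1 / 2) < strandHeight w y (k + 1 / 2) := by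
  rw [h.strandHeight_left (by linarith) (by linarith), h.strandHeight_right (by linarith)
    (by linarith), add_sub_cancel_left, smoothTransition_half]
  cases (w.get k).2 <;> norm_num

/-- Two strands whose projections meet are at a crossing, at the same time. -/
theorem exists_crossAt_of_fst_eq (hw : braidPerm w = 1) {x y : Fin n} (hxy : x ≠ y) {s t : ℝ}
    (h : (strandCurve w x s).1 = (strandCurve w y t).1) :
    (∃ m : ℤ, t = s + m) ∧ ∃ k : Fin w.length, wordTime w s = k + 1 / 2 ∧
      (CrossAt w k x y ∨ CrossAt w k y x) := by
  obtain ⟨h1, m, rfl⟩ := eq_of_radius_mul_turn_eq (strandRadius_wordTime_pos x s)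
    (strandRadius_wordTime_pos y t) h
  rw [wordTime_add_int] at h1
  exact ⟨⟨m, rfl⟩, exists_crossAt_of_strandRadius_eq hw hxy (wordTime_nonneg w s) h1⟩

theorem strandCurve_add_int (x : Fin n) (s : ℝ) (m : ℤ) :
    strandCurve w x (s + m) = strandCurve w x s := by
  have h : turn (s + m) = turn s := by
    have := (show Function.Periodic turn 1 from turn_add_one).int_mul m s
    simpa using this
  simp only [strandCurve, wordTime_add_int, h]

theorem isLink_strandCurves (hw : braidPerm w = 1) {ι : Type} {x : ι → Fin n}
    (hx : Function.Injective x) : IsLink (strandCurves w x) := by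
  have h := isLink_of_radius_pos (z := fun _ : ι => 0)
    (h := fun i v => strandHeight w (x i) (wordTime w v))
    (fun i => contDiff_strandRadius_wordTime hw (x i))
    (fun i => contDiff_strandHeight_wordTime (x i))
    (fun i => strandRadius_wordTime_periodic (x i)) (fun i => strandHeight_wordTime_periodic (x i))
    (fun i => strandRadius_wordTime_pos (x i)) ?_
  · simp only [zero_add] at h
    exact h
  · intro i j hij s t hst hh
    simp only [zero_add] at hst
    obtain ⟨⟨m, rfl⟩, k, hk, hc⟩ := exists_crossAt_of_fst_eq hw (hx.ne hij) hst
    rw [wordTime_add_int, hk] at hh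
    rcases hc with hc | hc
    · have := hc.strandHeight_lt
      split_ifs at this <;> linarith
    · have := hc.strandHeight_lt
      split_ifs at this <;> linarith

theorem hasDerivAt_wordTime {s : ℝ} (hs : 0 < wordTime w s) :
    HasDerivAt (wordTime w) (w.length + 1) s := by
  have hf : 0 < Int.fract s := by
    by_contra h
    have : Int.fract s = 0 := le_antisymm (not_lt.1 h) (Int.fract_nonneg s)
    simp [wordTime, this] at hs
  have h1 : HasDerivAt (fun v : ℝ => (v - ⌊s⌋) * (w.length + 1)) (w.length + 1) s := by
    simpa using ((hasDerivAt_id s).sub_const (⌊s⌋ : ℝ)).mul_const ((w.length : ℝ) + 1)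
  refine h1.congr_of_eventuallyEq ?_
  filter_upwards [Ioo_mem_nhds (a := (⌊s⌋ : ℝ)) (b := ⌊s⌋ + 1)
    (by linarith [Int.self_sub_floor s]) (Int.lt_floor_add_one s)] with v hv
  rw [wordTime, ← Int.self_sub_floor, Int.floor_eq_iff.2 ⟨hv.1.le, hv.2⟩]

/-- At a crossing, the strand that moves up has the larger radial velocity. -/
theorem CrossAt.deriv_strandRadius_lt {x y : Fin n} {k : Fin w.length}
    (h : CrossAt w k x y) {s : ℝ} (hs : wordTime w s = k + 1 / 2) :
    deriv (fun v => strandRadius w y (wordTime w v)) s <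
      deriv (fun v => strandRadius w x (wordTime w v)) s := by
  have hd : HasDerivAt (wordTime w) (w.length + 1) s := hasDerivAt_wordTime (by rw [hs]; positivity)
  have hev : ∀ᶠ v in nhds s, wordTime w v ∈ Set.Ioo (k : ℝ) (k + 1) :=
    hd.continuousAt (Ioo_mem_nhds (by rw [hs]; linarith) (by rw [hs]; linarith))
  have hT : HasDerivAt (fun v => Real.smoothTransition (wordTime w v - k))
      (deriv Real.smoothTransition (1 / 2) * (w.length + 1)) s := by
    have h1 : HasDerivAt Real.smoothTransition (deriv Real.smoothTransition (1 / 2))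
        (wordTime w s - k) := by
      rw [hs, add_sub_cancel_left]
      exact hasDerivAt_smoothTransition _
    exact HasDerivAt.comp s h1 (hd.sub_const _)
  have hx := (hT.const_add (1 + ((w.get k).1 : ℝ))).congr_of_eventuallyEq
    (f₁ := fun v => strandRadius w x (wordTime w v))
    (hev.mono fun v hv => h.strandRadius_left hv.1.le hv.2.le)
  have hy := (hT.const_sub (2 + ((w.get k).1 : ℝ))).congr_of_eventuallyEq
    (f₁ := fun v => strandRadius w y (wordTime w v))
    (hev.mono fun v hv => h.strandRadius_right hv.1.le hv.2.le)
  rw [hx.deriv, hy.deriv]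
  have : 0 < deriv Real.smoothTransition (1 / 2) * (w.length + 1) :=
    mul_pos deriv_smoothTransition_half_pos (by positivity)
  linarith

/-- Velocities of two curves with the same angular velocity are independent if the radial velocities
differ. -/
theorem linearIndependent_of_ne {a b r : ℝ} {e : ℂ} (he : e ≠ 0) (hr : r ≠ 0) (hab : a ≠ b) :
    LinearIndependent ℝ ![(a + r * Complex.I) * e, (b + r * Complex.I) * e] := by
  rw [LinearIndependent.pair_iff]
  intro c d h
  have h1 : (((c * a + d * b : ℝ) : ℂ) + ((c * r + d * r : ℝ) : ℂ) * Complex.I) = 0 := by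
    refine (mul_eq_zero.1 ?_).resolve_right he
    rw [← h]
    simp only [Complex.real_smul]
    push_cast
    ring
  have hre := congrArg Complex.re h1
  have him := congrArg Complex.im h1
  simp at hre him
  have hcd : c + d = 0 := by
    have : r * (c + d) = 0 := by linarith
    exact (mul_eq_zero.1 this).resolve_left hr
  have hc : c * (a - b) = 0 := by linear_combination hre - b * hcd
  have hc0 := (mul_eq_zero.1 hc).resolve_right (sub_ne_zero.2 hab)
  exact ⟨hc0, by linarith⟩

theorem isDiagram_strandCurves (hw : braidPerm w = 1) {ι : Type} {x : ι → Fin n}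
    (hx : Function.Injective x) : IsDiagram (strandCurves w x) where
  immersion i s := by
    simpa [strandCurves, strandCurve] using deriv_radius_mul_turn_ne_zero
      (contDiff_strandRadius_wordTime hw (x i)) (strandRadius_wordTime_pos (x i)) 0 s
  transverse i s j t hst hne := by
    have hij : i ≠ j := by
      rintro rfl
      exact hne ⟨rfl, (eq_of_radius_mul_turn_eq (strandRadius_wordTime_pos (x i) s)
        (strandRadius_wordTime_pos (x i) t) hst).2⟩
    have hd : ∀ (y : Fin n) (v : ℝ), deriv (fun u => (strandCurve w y u).1) v = _ := fun y v =>
      (hasDerivAt_radius_mul_turn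
        (((contDiff_strandRadius_wordTime hw y).differentiable (by simp)) v).hasDerivAt).deriv
    obtain ⟨⟨m, rfl⟩, k, hk, hc⟩ := exists_crossAt_of_fst_eq hw (hx.ne hij) hst
    have hk' : wordTime w (s + m) = k + 1 / 2 := by rw [wordTime_add_int, hk]
    have hshift : (fun u => (strandCurves w x j u).1) =
        fun u => (strandCurve w (x j) (u + (-m : ℤ))).1 := by
      funext u
      simp only [strandCurves, strandCurve_add_int]
    have hdj : deriv (fun u => (strandCurves w x j u).1) (s + m) =
        deriv (fun u => (strandCurve w (x j) u).1) s := by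
      rw [hshift, deriv_comp_add_const (f := fun u => (strandCurve w (x j) u).1)]
      congr 1
      push_cast
      ring
    have hrad := (eq_of_radius_mul_turn_eq (strandRadius_wordTime_pos (x i) s)
      (strandRadius_wordTime_pos (x j) (s + m)) hst).1
    rw [wordTime_add_int] at hrad
    rw [hdj]
    simp only [strandCurves, hd]
    rw [← hrad]
    have hpos := strandRadius_wordTime_pos (w := w) (x i) s
    have hpi := Real.pi_pos
    have key := linearIndependent_of_ne (turn_ne_zero s)
      (r := 2 * Real.pi * strandRadius w (x i) (wordTime w s)) (by positivity)
      (a := deriv (fun v => strandRadius w (x i) (wordTime w v)) s)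
      (b := deriv (fun v => strandRadius w (x j) (wordTime w v)) s)
      (by
        rcases hc with hc | hc
        · exact (hc.deriv_strandRadius_lt hk).ne'
        · exact (hc.deriv_strandRadius_lt hk).ne)
    push_cast at key
    exact key
  no_triple i s j t k u h1 h2 := by
    have same : ∀ {i j : ι} {s t : ℝ}, i = j → (strandCurves w x i s).1 = (strandCurves w x j t).1 →
        SamePoint i s j t := by
      rintro i j s t rfl h
      exact ⟨rfl, (eq_of_radius_mul_turn_eq (strandRadius_wordTime_pos (x i) s)
        (strandRadius_wordTime_pos (x i) t) h).2⟩
    by_cases hij : i = j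
    · exact Or.inl (same hij h1)
    by_cases hjk : j = k
    · exact Or.inr (Or.inl (same hjk h2))
    by_cases hik : i = k
    · exact Or.inr (Or.inr (same hik (h1.trans h2)))
    -- The three strands are at the same crossing, which involves two positions only.
    exfalso
    obtain ⟨-, a, ha, hca⟩ := exists_crossAt_of_fst_eq hw (hx.ne hij) h1
    obtain ⟨-, b, hb, hcb⟩ := exists_crossAt_of_fst_eq hw (hx.ne hik) (h1.trans h2)
    have hab : a = b := by
      have : (a : ℝ) = (b : ℕ) := by linarith
      exact Fin.ext (by exact_mod_cast this)
    subst hab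
    have inj := strandPos_injective w (a : ℕ)
    rcases hca with hca | hca <;> rcases hcb with hcb | hcb
    · exact hjk (hx (inj (hca.2.trans hcb.2.symm)))
    · exact hik (hx (inj (hca.1.trans hcb.1.symm)))
    · exact hij (hx (inj (hca.1.trans hcb.1.symm))).symm
    · exact hjk (hx (inj (hca.1.trans hcb.1.symm)))

end Word

/-! ### Unlinking a layered braid -/

section Unlink
variable {n : ℕ} {w : BraidWord n}

/-- If at every crossing the strand that starts in the lower position is on top, then the strands of
the closure can be lifted into separate layers, where each can be straightened. -/
theorem isUnlink_strandCurves (hw : braidPerm w = 1)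
    (hlay : ∀ k x y, CrossAt w k x y → ((w.get k).2 = true ↔ x < y)) {ι : Type} {x : ι → Fin n}
    (hx : Function.Injective x) : IsUnlink (strandCurves w x) := by
  set T := Real.smoothTransition with hT
  set r : ι → ℝ → ℝ := fun i v => strandRadius w (x i) (wordTime w v) with hr
  set h : ι → ℝ → ℝ := fun i v => strandHeight w (x i) (wordTime w v) with hh
  have cr : ∀ i, ContDiff ℝ ∞ (r i) := fun i => contDiff_strandRadius_wordTime hw (x i)
  have ch : ∀ i, ContDiff ℝ ∞ (h i) := fun i => contDiff_strandHeight_wordTime (x i)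
  have r0 : ∀ i s, 0 < r i s := fun i => strandRadius_wordTime_pos (x i)
  have hI : ∀ i s, h i s ∈ Set.Icc (0 : ℝ) 1 := fun i s =>
    strandHeight_mem_Icc w (x i) (wordTime_nonneg w s)
  refine ⟨fun i => x i, fun i j hij => hx (Fin.ext hij), fun τ i s =>
    (((T (3 * τ - 1) * (3 * (x i : ℕ)) : ℝ) : ℂ) +
        (((1 - T (3 * τ - 1)) * r i s + T (3 * τ - 1) : ℝ) : ℂ) * turn s,
      (1 - T (3 * τ - 1)) * h i s - 2 * (x i : ℕ) * (T (3 * τ) * (1 - T (3 * τ - 2)))),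
    fun i => ?_, fun τ _ => ?_, ?_, ?_⟩
  · have cT : ContDiff ℝ ∞ T := Real.smoothTransition.contDiff
    have c3 : ContDiff ℝ ∞ fun q : ℝ × ℝ => 3 * q.1 := contDiff_const.mul contDiff_fst
    have a := cT.comp c3
    have b := cT.comp (c3.sub (contDiff_const (c := (1 : ℝ))))
    have c := cT.comp (c3.sub (contDiff_const (c := (2 : ℝ))))
    have b' := (contDiff_const (c := (1 : ℝ))).sub b
    have r' := (cr i).comp (contDiff_snd (E := ℝ) (F := ℝ))
    have h' := (ch i).comp (contDiff_snd (E := ℝ) (F := ℝ))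
    exact ((Complex.ofRealCLM.contDiff.comp (b.mul contDiff_const)).add
      ((Complex.ofRealCLM.contDiff.comp ((b'.mul r').add b)).mul
        (contDiff_turn.comp contDiff_snd))).prodMk
      ((b'.mul h').sub (contDiff_const.mul (a.mul (contDiff_const.sub c))))
  · have hb0 := Real.smoothTransition.nonneg (3 * τ - 1)
    have hb1 := Real.smoothTransition.le_one (3 * τ - 1)
    refine isLink_of_radius_pos (z := fun i => ((T (3 * τ - 1) * (3 * (x i : ℕ)) : ℝ) : ℂ))
      (r := fun i s => (1 - T (3 * τ - 1)) * r i s + T (3 * τ - 1))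
      (h := fun i s => (1 - T (3 * τ - 1)) * h i s -
        2 * (x i : ℕ) * (T (3 * τ) * (1 - T (3 * τ - 2))))
      (fun i => (contDiff_const.mul (cr i)).add contDiff_const)
      (fun i => (contDiff_const.mul (ch i)).sub contDiff_const)
      (fun i s => by simp only [hr, strandRadius_wordTime_periodic (x i) s])
      (fun i s => by simp only [hh, strandHeight_wordTime_periodic (x i) s])
      (fun i s => ?_) fun i j hij s t hst hst' => ?_
    · rcases hb1.lt_or_eq with hlt | heq
      · have := mul_pos (sub_pos.2 hlt) (r0 i s)
        linarith
      · simp [hT, heq]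
    · wlog hlt : x i < x j generalizing i j s t
      · exact this j i hij.symm t s hst.symm hst'.symm
          (lt_of_le_of_ne (not_lt.1 hlt) (hx.ne hij.symm))
      have hlt' : ((x i : ℕ) : ℝ) + 1 ≤ (x j : ℕ) := by exact_mod_cast hlt
      rcases le_or_gt (3 * τ) 1 with h1 | h1
      · -- Lifting into layers: the upper strand of every crossing is lifted more.
        have hb : T (3 * τ - 1) = 0 := Real.smoothTransition.zero_of_nonpos (by linarith)
        have hc : T (3 * τ - 2) = 0 := Real.smoothTransition.zero_of_nonpos (by linarith)
        have ha : 0 ≤ T (3 * τ) := Real.smoothTransition.nonneg _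
        simp only [hb, hc, zero_mul, Complex.ofReal_zero, zero_add, sub_zero, one_mul, add_zero,
          mul_one] at hst hst'
        obtain ⟨⟨m, rfl⟩, k, hk, hcr⟩ := exists_crossAt_of_fst_eq hw hlt.ne hst
        simp only [hh, wordTime_add_int, hk] at hst'
        have hover : strandHeight w (x j) (k + 1 / 2) < strandHeight w (x i) (k + 1 / 2) := by
          rcases hcr with hcr | hcr
          · have := hcr.strandHeight_lt
            rwa [if_pos ((hlay _ _ _ hcr).2 hlt)] at this
          · have := hcr.strandHeight_lt
            rwa [if_neg fun h => hlt.not_gt ((hlay _ _ _ hcr).1 h)] at this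
        nlinarith
      · have ha : T (3 * τ) = 1 := Real.smoothTransition.one_of_one_le h1.le
        rcases le_or_gt (3 * τ) 2 with h2 | h2
        · have hc : T (3 * τ - 2) = 0 := Real.smoothTransition.zero_of_nonpos (by linarith)
          simp only [ha, hc, sub_zero, mul_one] at hst'
          have hbi : 0 ≤ (1 - T (3 * τ - 1)) * h i s :=
            mul_nonneg (sub_nonneg.2 hb1) (hI i s).1
          have hbj : (1 - T (3 * τ - 1)) * h j t ≤ 1 :=
            mul_le_one₀ (by linarith) (hI j t).1 (hI j t).2
          linarith
        · -- Unit circles whose centres have distance at least `3`.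
          have hb : T (3 * τ - 1) = 1 := Real.smoothTransition.one_of_one_le (by linarith)
          simp only [hb, sub_self, zero_mul, zero_add, one_mul, Complex.ofReal_one] at hst
          have e1 : ((3 * ((x j : ℕ) : ℝ) - 3 * ((x i : ℕ) : ℝ) : ℝ) : ℂ) = turn s - turn t := by
            push_cast at hst ⊢
            linear_combination -hst
          have e2 := congrArg norm e1
          rw [Complex.norm_real, Real.norm_eq_abs] at e2
          have e3 := norm_sub_le (turn s) (turn t)
          rw [norm_turn, norm_turn, ← e2] at e3
          have := le_abs_self (3 * ((x j : ℕ) : ℝ) - 3 * ((x i : ℕ) : ℝ))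
          linarith
  · have hb : T (3 * 0 - 1) = 0 := Real.smoothTransition.zero_of_nonpos (by norm_num)
    have ha : T (3 * 0) = 0 := Real.smoothTransition.zero_of_nonpos (by norm_num)
    funext i s
    simp only [hb, ha]
    simp [strandCurves, strandCurve, hr, hh]
  · have hb : T (3 * 1 - 1) = 1 := Real.smoothTransition.one_of_one_le (by norm_num)
    have hc : T (3 * 1 - 2) = 1 := Real.smoothTransition.one_of_one_le (by norm_num)
    funext i s
    simp only [hb, hc]
    simp [roundCircles, turn]

end Unlink

/-! ### Strands that cross twice positively -/

/-- The radial component of a loop that turns once clockwise around the origin, as a function of the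
time: it crosses the vertical axis upwards during `[a, a + 1]`, and back during `[b, b + 1]`. -/
def loopRadius (a b u : ℝ) : ℝ :=
  -1 + 2 * Real.smoothTransition (u - a) - 2 * Real.smoothTransition (u - b)

/-- The vertical component of the loop whose radial component is `loopRadius`. -/
def loopHeight (a b u : ℝ) : ℝ :=
  Real.smoothTransition (u - a) * (1 - Real.smoothTransition (u - a)) -
    Real.smoothTransition (u - b) * (1 - Real.smoothTransition (u - b))

theorem contDiff_smoothTransition_sub (a : ℝ) :
    ContDiff ℝ ∞ fun u => Real.smoothTransition (u - a) :=
  Real.smoothTransition.contDiff.comp (contDiff_id.sub contDiff_const)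

theorem contDiff_loopRadius (a b : ℝ) : ContDiff ℝ ∞ (loopRadius a b) :=
  (contDiff_const.add (contDiff_const.mul (contDiff_smoothTransition_sub a))).sub
    (contDiff_const.mul (contDiff_smoothTransition_sub b))

theorem contDiff_loopHeight (a b : ℝ) : ContDiff ℝ ∞ (loopHeight a b) :=
  ((contDiff_smoothTransition_sub a).mul
    (contDiff_const.sub (contDiff_smoothTransition_sub a))).sub
  ((contDiff_smoothTransition_sub b).mul (contDiff_const.sub (contDiff_smoothTransition_sub b)))

/-- The loop with the components `loopRadius` and `loopHeight` turns clockwise.  With `P` the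
value of the active transition function, `A B' - B A' = -P' (P ^ 2 + (1 - P) ^ 2)`. -/
theorem loop_clockwise {a b : ℝ} (hab : a + 1 ≤ b) (u : ℝ) :
    loopRadius a b u * deriv (loopHeight a b) u - loopHeight a b u * deriv (loopRadius a b) u ≤ 0 ∧
      (u = a + 1 / 2 → loopRadius a b u * deriv (loopHeight a b) u -
        loopHeight a b u * deriv (loopRadius a b) u < 0) := by
  have hT : ∀ c : ℝ, HasDerivAt (fun u => Real.smoothTransition (u - c))
      (deriv Real.smoothTransition (u - c)) u := fun c =>
    (hasDerivAt_smoothTransition (u - c)).comp_sub_const u c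
  have hr : HasDerivAt (loopRadius a b) _ u :=
    (((hT a).const_mul 2).const_add (-1)).sub ((hT b).const_mul 2)
  have hh : HasDerivAt (loopHeight a b) _ u :=
    ((hT a).mul ((hT a).const_sub 1)).sub ((hT b).mul ((hT b).const_sub 1))
  rw [hr.deriv, hh.deriv]
  simp only [loopRadius, loopHeight]
  have ha := deriv_smoothTransition_nonneg (u - a)
  have hb := deriv_smoothTransition_nonneg (u - b)
  constructor
  · rcases le_total u b with h | h
    · rw [Real.smoothTransition.zero_of_nonpos (x := u - b) (by linarith),
        deriv_smoothTransition_of_nonpos (x := u - b) (by linarith)]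
      generalize Real.smoothTransition (u - a) = P
      nlinarith [mul_nonneg ha (sq_nonneg (1 - P)), mul_nonneg ha (sq_nonneg P)]
    · rw [Real.smoothTransition.one_of_one_le (x := u - a) (by linarith),
        deriv_smoothTransition_of_one_le (x := u - a) (by linarith)]
      generalize Real.smoothTransition (u - b) = P
      nlinarith [mul_nonneg hb (sq_nonneg (1 - P)), mul_nonneg hb (sq_nonneg P)]
  · rintro rfl
    rw [Real.smoothTransition.zero_of_nonpos (x := a + 1 / 2 - b) (by linarith),
      deriv_smoothTransition_of_nonpos (x := a + 1 / 2 - b) (by linarith), add_sub_cancel_left,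
      smoothTransition_half]
    linarith [deriv_smoothTransition_half_pos]

section Word
variable {n : ℕ} {w : BraidWord n}

/-- Two strands that cross exactly twice, with both crossings positive, are linked. The last three
hypotheses say that they change their order only at the letters `a` and `b`. -/
theorem linkingAngle_strandCurve_ne_zero (hw : braidPerm w = 1) {x y : Fin n} {a b : Fin w.length}
    (hab : a < b) (ca : CrossAt w a x y) (cb : CrossAt w b y x) (ha : (w.get a).2 = true)
    (hb : (w.get b).2 = true) (h1 : ∀ k ≤ (a : ℕ), strandPos w x k < strandPos w y k)
    (h2 : ∀ k, (a : ℕ) < k → k ≤ b → strandPos w y k < strandPos w x k)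
    (h3 : ∀ k, (b : ℕ) < k → k ≤ w.length → strandPos w x k < strandPos w y k) :
    linkingAngle (strandCurve w x) (strandCurve w y) ≠ 0 := by
  have hab' : ((a : ℕ) : ℝ) + 1 ≤ (b : ℕ) := by exact_mod_cast hab
  have ha0 : (0 : ℝ) ≤ (a : ℕ) := Nat.cast_nonneg _
  have hbl : ((b : ℕ) : ℝ) + 1 ≤ w.length := by exact_mod_cast b.isLt
  have T0 : ∀ {x : ℝ}, x ≤ 0 → Real.smoothTransition x = 0 := Real.smoothTransition.zero_of_nonpos
  have T1 : ∀ {x : ℝ}, 1 ≤ x → Real.smoothTransition x = 1 := Real.smoothTransition.one_of_one_le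
  have r0 : ∀ u ≤ 0, loopRadius (a : ℕ) (b : ℕ) u = -1 := fun u hu => by
    rw [loopRadius, T0 (by linarith), T0 (by linarith)]; ring
  have r1 : ∀ u, (w.length : ℝ) ≤ u → loopRadius (a : ℕ) (b : ℕ) u = -1 := fun u hu => by
    rw [loopRadius, T1 (by linarith), T1 (by linarith)]; ring
  have z0 : ∀ u ≤ 0, loopHeight (a : ℕ) (b : ℕ) u = 0 := fun u hu => by
    rw [loopHeight, T0 (by linarith), T0 (by linarith)]; ring
  have z1 : ∀ u, (w.length : ℝ) ≤ u → loopHeight (a : ℕ) (b : ℕ) u = 0 := fun u hu => by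
    rw [loopHeight, T1 (by linarith), T1 (by linarith)]; ring
  have hder : ∀ v, loopRadius (a : ℕ) (b : ℕ) (wordTime w v) *
      deriv (fun v => loopHeight (a : ℕ) (b : ℕ) (wordTime w v)) v -
      loopHeight (a : ℕ) (b : ℕ) (wordTime w v) *
        deriv (fun v => loopRadius (a : ℕ) (b : ℕ) (wordTime w v)) v =
      (loopRadius (a : ℕ) (b : ℕ) (wordTime w v) *
        deriv (loopHeight (a : ℕ) (b : ℕ)) (wordTime w v) -
      loopHeight (a : ℕ) (b : ℕ) (wordTime w v) *
        deriv (loopRadius (a : ℕ) (b : ℕ)) (wordTime w v)) * (w.length + 1) := by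
    intro v
    have e1 := deriv_fract_mul ((contDiff_loopHeight (a : ℕ) (b : ℕ)).differentiable (by simp))
      z0 z1 v
    have e2 := deriv_fract_mul ((contDiff_loopRadius (a : ℕ) (b : ℕ)).differentiable (by simp))
      r0 r1 v
    simp only [wordTime]
    rw [e1, e2]
    ring
  have hm : (0 : ℝ) < w.length + 1 := by positivity
  have ht₀ : ((a : ℕ) + 1 / 2 : ℝ) / (w.length + 1) ∈ Set.Ioo (0 : ℝ) 1 :=
    ⟨by positivity, by rw [div_lt_one hm]; linarith⟩
  have hwt : wordTime w (((a : ℕ) + 1 / 2 : ℝ) / (w.length + 1)) = (a : ℕ) + 1 / 2 := by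
    rw [wordTime, Int.fract_eq_self.2 ⟨ht₀.1.le, ht₀.2⟩, div_mul_cancel₀ _ hm.ne']
  refine linkingAngle_ne_zero_of_loop (A := fun v => loopRadius (a : ℕ) (b : ℕ) (wordTime w v))
    (B := fun v => loopHeight (a : ℕ) (b : ℕ) (wordTime w v)) (fun _ => rfl) (fun _ => rfl)
    (contDiff_strandRadius_wordTime hw x) (contDiff_strandHeight_wordTime x)
    (contDiff_strandRadius_wordTime hw y) (contDiff_strandHeight_wordTime y)
    (contDiff_fract_mul (contDiff_loopRadius _ _) r0 r1)
    (contDiff_fract_mul (contDiff_loopHeight _ _) z0 z1)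
    (strandRadius_wordTime_periodic x) (strandHeight_wordTime_periodic x)
    (strandRadius_wordTime_periodic y) (strandHeight_wordTime_periodic y)
    (periodic_fract_mul _ _) (periodic_fract_mul _ _)
    (strandRadius_wordTime_pos x) (strandRadius_wordTime_pos y) (fun t => ?_) (fun t => ?_)
    ht₀ ?_
  · have hu := wordTime_nonneg w t
    generalize wordTime w t = u at *
    rcases exists_letter_or_length_le (m := w.length) hu with ⟨k, k1, k2⟩ | h
    · have lt {c : Fin w.length} (h : k < c) : ((k : ℕ) : ℝ) + 1 ≤ (c : ℕ) := by exact_mod_cast h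
      have gt {c : Fin w.length} (h : c < k) : ((c : ℕ) : ℝ) + 1 ≤ (k : ℕ) := by exact_mod_cast h
      -- At the two crossings, the loop agrees with the vector from one strand to the other.
      have same : ∀ r z : ℝ, r = strandRadius w x u - strandRadius w y u →
          z = strandHeight w x u - strandHeight w y u → (r = 0 → z ≠ 0) →
          0 < r * (strandRadius w x u - strandRadius w y u) ∨
            0 < z * (strandHeight w x u - strandHeight w y u) := by
        rintro r z rfl rfl hne
        by_cases h0 : strandRadius w x u - strandRadius w y u = 0
        · exact Or.inr (mul_self_pos.2 (hne h0))
        · exact Or.inl (mul_self_pos.2 h0)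
      rcases lt_trichotomy k a with hka | rfl | hka
      · left
        have h4 := strandRadius_lt (h1 k (Nat.le_of_lt hka)) (h1 (k + 1) hka) k1 k2.le
        have h5 := lt hka
        rw [loopRadius, T0 (by linarith), T0 (by linarith)]
        linarith
      · refine same _ _ ?_ ?_ ?_
        · rw [ca.strandRadius_left k1 k2.le, ca.strandRadius_right k1 k2.le, loopRadius,
            T0 (x := u - (b : ℕ)) (by linarith)]
          ring
        · rw [ca.strandHeight_left k1 k2.le, ca.strandHeight_right k1 k2.le, loopHeight,
            T0 (x := u - (b : ℕ)) (by linarith), if_pos ha, if_pos ha]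
          ring
        · rw [loopRadius, loopHeight, T0 (x := u - (b : ℕ)) (by linarith)]
          intro h4
          have : Real.smoothTransition (u - (k : ℕ)) = 1 / 2 := by linarith
          rw [this]
          norm_num
      · rcases lt_trichotomy k b with hkb | rfl | hkb
        · left
          have h4 := strandRadius_lt (h2 k hka (Nat.le_of_lt hkb))
            (h2 (k + 1) (Nat.lt_succ_of_lt hka) hkb) k1 k2.le
          have h5 := lt hkb
          have h6 := gt hka
          rw [loopRadius, T1 (by linarith), T0 (by linarith)]
          linarith
        · refine same _ _ ?_ ?_ ?_
          · rw [cb.strandRadius_left k1 k2.le, cb.strandRadius_right k1 k2.le, loopRadius,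
              T1 (x := u - (a : ℕ)) (by linarith)]
            ring
          · rw [cb.strandHeight_left k1 k2.le, cb.strandHeight_right k1 k2.le, loopHeight,
              T1 (x := u - (a : ℕ)) (by linarith), if_pos hb, if_pos hb]
            ring
          · rw [loopRadius, loopHeight, T1 (x := u - (a : ℕ)) (by linarith)]
            intro h4
            have : Real.smoothTransition (u - (k : ℕ)) = 1 / 2 := by linarith
            rw [this]
            norm_num
        · left
          have h4 := strandRadius_lt (h3 k hkb k.isLt.le)
            (h3 (k + 1) (Nat.lt_succ_of_lt hkb) k.isLt) k1 k2.le
          have h6 := gt hkb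
          rw [loopRadius, T1 (by linarith), T1 (by linarith)]
          linarith
    · left
      have hxy : ((x : ℕ) : ℝ) < (y : ℕ) := by
        have := h1 0 (Nat.zero_le _)
        rw [strandPos_zero, strandPos_zero] at this
        exact_mod_cast this
      rw [r1 _ h, strandRadius_of_length_le w x h, strandRadius_of_length_le w y h, hw]
      simp only [Equiv.Perm.one_apply]
      linarith
  · rw [hder]
    exact mul_nonpos_of_nonpos_of_nonneg (loop_clockwise hab' _).1 hm.le
  · rw [hder]
    exact mul_neg_of_neg_of_pos ((loop_clockwise hab' _).2 hwt) hm

end Word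

/-! ### Switching letters of a braid word -/

section Switch
variable {n : ℕ} {v w : BraidWord n}

theorem braidPerm_congr (h : v.map Prod.fst = w.map Prod.fst) : braidPerm v = braidPerm w := by
  induction v generalizing w with
  | nil =>
    cases w with
    | nil => rfl
    | cons => simp at h
  | cons l v ih =>
    cases w with
    | nil => simp at h
    | cons l' w =>
      simp only [List.map_cons, List.cons.injEq] at h
      simp only [braidPerm, ih h.2, h.1]

theorem strandPos_congr (h : v.map Prod.fst = w.map Prod.fst) : strandPos v = strandPos w := by
  funext x k
  rw [strandPos, strandPos, braidPerm_congr]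
  rw [List.map_take, List.map_take, h]

theorem strandRadius_congr (h : v.map Prod.fst = w.map Prod.fst) :
    strandRadius v = strandRadius w := by
  have hl : v.length = w.length := by simpa using congrArg List.length h
  funext x u
  simp only [strandRadius, strandPos_congr h]
  rw [Fin.sum_univ_eq_sum_range (fun k : ℕ => (((strandPos w x (k + 1) : ℕ) : ℝ) -
    ((strandPos w x k : ℕ) : ℝ)) * Real.smoothTransition (u - k)), hl,
    ← Fin.sum_univ_eq_sum_range (fun k : ℕ => (((strandPos w x (k + 1) : ℕ) : ℝ) -
    ((strandPos w x k : ℕ) : ℝ)) * Real.smoothTransition (u - k))]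

theorem length_switchAt (w : BraidWord n) (S : Finset ℕ) : (switchAt w S).length = w.length := by
  simp [switchAt]

theorem get_switchAt (w : BraidWord n) (S : Finset ℕ) (k : Fin (switchAt w S).length) :
    (switchAt w S).get k = if (k : ℕ) + 1 ∈ S then
      ((w.get (k.cast (length_switchAt w S))).1, !(w.get (k.cast (length_switchAt w S))).2)
      else w.get (k.cast (length_switchAt w S)) := by
  exact List.getElem_mapIdx

theorem get_switchAt_fst (w : BraidWord n) (S : Finset ℕ) (k : Fin (switchAt w S).length) :
    ((switchAt w S).get k).1 = (w.get (k.cast (length_switchAt w S))).1 := by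
  rw [get_switchAt]
  split_ifs <;> rfl

theorem map_fst_switchAt (w : BraidWord n) (S : Finset ℕ) :
    (switchAt w S).map Prod.fst = w.map Prod.fst := by
  refine List.ext_getElem (by simp [switchAt]) fun k h1 h2 => ?_
  have := get_switchAt_fst w S ⟨k, by simpa using h1⟩
  simpa using this

theorem crossAt_switchAt {S : Finset ℕ} {k : Fin (switchAt w S).length} {x y : Fin n} :
    CrossAt (switchAt w S) k x y ↔ CrossAt w (k.cast (length_switchAt w S)) x y := by
  rw [CrossAt, CrossAt, strandPos_congr (map_fst_switchAt w S), get_switchAt_fst]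
  rfl

theorem strandCurves_switchAt_fst (S : Finset ℕ) {ι : Type} (x : ι → Fin n) (i : ι) (s : ℝ) :
    (strandCurves (switchAt w S) x i s).1 = (strandCurves w x i s).1 := by
  simp only [strandCurves, strandCurve, wordTime, length_switchAt,
    strandRadius_congr (map_fst_switchAt w S)]

/-- The point of the plane at which the letter number `k` of a closed braid has its crossing. -/
def crossingPoint (w : BraidWord n) (k : Fin w.length) : ℂ :=
  ((((w.get k).1 : ℕ) + 3 / 2 : ℝ) : ℂ) * turn ((k + 1 / 2) / (w.length + 1))

theorem crossingTime_mem (k : Fin w.length) :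
    ((k : ℕ) + 1 / 2 : ℝ) / (w.length + 1) ∈ Set.Ico (0 : ℝ) 1 := by
  have : ((k : ℕ) : ℝ) + 1 ≤ w.length := by exact_mod_cast k.isLt
  exact ⟨by positivity, by rw [div_lt_one (by positivity)]; linarith⟩

theorem wordTime_crossingTime (k : Fin w.length) :
    wordTime w (((k : ℕ) + 1 / 2 : ℝ) / (w.length + 1)) = k + 1 / 2 := by
  rw [wordTime, Int.fract_eq_self.2 (crossingTime_mem k), div_mul_cancel₀ _ (by positivity)]

theorem crossingPoint_injective (w : BraidWord n) : Function.Injective (crossingPoint w) := by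
  intro k l h
  obtain ⟨-, m, hm⟩ := eq_of_radius_mul_turn_eq (by positivity) (by positivity) h
  have h1 := wordTime_crossingTime (w := w) l
  rw [hm, wordTime_add_int, wordTime_crossingTime] at h1
  have : ((k : ℕ) : ℝ) = (l : ℕ) := by linarith
  exact Fin.ext (by exact_mod_cast this)

theorem CrossAt.strandRadius_half {k : Fin w.length} {x y : Fin n} (h : CrossAt w k x y) :
    strandRadius w x (k + 1 / 2) = (w.get k).1 + 3 / 2 ∧
      strandRadius w y (k + 1 / 2) = (w.get k).1 + 3 / 2 := by
  rw [h.strandRadius_left (by linarith) (by linarith), h.strandRadius_right (by linarith)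
    (by linarith), add_sub_cancel_left, smoothTransition_half]
  constructor <;> ring

theorem CrossAt.fst_strandCurve {k : Fin w.length} {x y : Fin n}
    (h : CrossAt w k x y ∨ CrossAt w k y x) {s : ℝ} (hs : wordTime w s = k + 1 / 2) :
    (strandCurve w x s).1 = crossingPoint w k := by
  have h1 : strandRadius w x (k + 1 / 2) = (w.get k).1 + 3 / 2 := by
    rcases h with h | h
    · exact h.strandRadius_half.1
    · exact h.strandRadius_half.2
  have h2 : turn s = turn ((k + 1 / 2) / (w.length + 1)) := by
    have h3 : (k + 1 / 2 : ℝ) / (w.length + 1) = Int.fract s := by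
      rw [← hs, wordTime, mul_div_cancel_right₀ _ (by positivity)]
    have := (show Function.Periodic turn 1 from turn_add_one).int_mul ⌊s⌋ (Int.fract s)
    rw [h3, ← this, mul_one, Int.fract_add_floor]
  simp only [strandCurve, hs, h1, h2, crossingPoint]

/-- The crossings of the closed braid that change when letters are switched are those of the
switched letters. -/
theorem encard_switchedCrossings (hw : braidPerm w = 1) {ι : Type} {x : ι → Fin n}
    (hx : Function.Bijective x) {S : Finset ℕ} (hS : S ⊆ Finset.Icc 1 w.length) :
    (switchedCrossings (strandCurves w x) (strandCurves (switchAt w S) x)).encard = S.card := by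
  set w' := switchAt w S with hw'
  have hlen : w.length = w'.length := (length_switchAt w S).symm
  have hwt : wordTime w' = wordTime w := by
    funext s
    simp only [wordTime, hlen]
  have hcross : ∀ {k : Fin w.length} {a b : Fin n}, CrossAt w k a b →
      CrossAt w' (k.cast hlen) a b := fun h => crossAt_switchAt.2 h
  have hset : switchedCrossings (strandCurves w x) (strandCurves w' x) =
      crossingPoint w '' {k | (k : ℕ) + 1 ∈ S} := by
    ext z
    constructor
    · rintro ⟨i, s, j, t, hi, hj, hlt, hlt'⟩
      have hij : i ≠ j := by
        rintro rfl
        obtain ⟨m, rfl⟩ := (eq_of_radius_mul_turn_eq (strandRadius_wordTime_pos (x i) s)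
          (strandRadius_wordTime_pos (x i) t) (hi.trans hj.symm)).2
        simp [strandCurves, strandCurve_add_int] at hlt
      obtain ⟨⟨m, rfl⟩, k, hk, hc⟩ := exists_crossAt_of_fst_eq hw (hx.1.ne hij) (hi.trans hj.symm)
      refine ⟨k, ?_, (CrossAt.fst_strandCurve hc hk).symm.trans hi⟩
      by_contra hkS
      have hget : w'.get (k.cast hlen) = w.get k := by
        rw [get_switchAt, if_neg (by simpa using hkS)]
        rfl
      simp only [strandCurves, strandCurve_add_int] at hlt hlt'
      simp only [strandCurve, hwt, hk] at hlt hlt'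
      rcases hc with hc | hc
      · have g1 := hc.strandHeight_lt
        have g2 := (hcross hc).strandHeight_lt
        rw [hget] at g2
        simp only [Fin.val_cast] at g2
        split_ifs at g1 g2 <;> linarith
      · have g1 := hc.strandHeight_lt
        have g2 := (hcross hc).strandHeight_lt
        rw [hget] at g2
        simp only [Fin.val_cast] at g2
        split_ifs at g1 g2 <;> linarith
    · rintro ⟨k, hkS, rfl⟩
      obtain ⟨a, ha⟩ : ∃ a, strandPos w a k = lowPos (w.get k).1 :=
        (braidPerm (w.take k)).surjective _
      obtain ⟨b, hb⟩ : ∃ b, strandPos w b k = highPos (w.get k).1 :=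
        (braidPerm (w.take k)).surjective _
      obtain ⟨i, rfl⟩ := hx.2 a
      obtain ⟨j, rfl⟩ := hx.2 b
      have hc : CrossAt w k (x i) (x j) := ⟨ha, hb⟩
      have hk := wordTime_crossingTime k
      have pi := CrossAt.fst_strandCurve (Or.inl hc) hk
      have pj := CrossAt.fst_strandCurve (Or.inr hc) hk
      have hget : w'.get (k.cast hlen) = ((w.get k).1, !(w.get k).2) := by
        rw [get_switchAt, if_pos (by simpa using hkS)]
        rfl
      have g1 := hc.strandHeight_lt
      have g2 := (hcross hc).strandHeight_lt
      rw [hget] at g2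
      simp only [Fin.val_cast] at g2
      cases h2 : (w.get k).2
      · simp only [h2, Bool.false_eq_true, if_false, Bool.not_false, if_true] at g1 g2
        exact ⟨i, _, j, _, pi, pj, by simpa only [strandCurves, strandCurve, hk] using g1,
          by simpa only [strandCurves, strandCurve, hwt, hk] using g2⟩
      · simp only [h2, Bool.false_eq_true, if_false, Bool.not_true, if_true] at g1 g2
        exact ⟨j, _, i, _, pj, pi, by simpa only [strandCurves, strandCurve, hk] using g1,
          by simpa only [strandCurves, strandCurve, hwt, hk] using g2⟩
  rw [hset, (crossingPoint_injective w).encard_image]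
  have himg : (S : Set ℕ) = (fun k : Fin w.length => (k : ℕ) + 1) '' {k | (k : ℕ) + 1 ∈ S} := by
    ext N
    constructor
    · intro hN
      have h1 := Finset.mem_Icc.1 (hS hN)
      refine ⟨⟨N - 1, by omega⟩, ?_, ?_⟩
      · have : N - 1 + 1 = N := by omega
        simpa [this] using hN
      · simp only
        omega
    · rintro ⟨k, hk, rfl⟩
      exact hk
  rw [← Set.encard_coe_eq_coe_finsetCard, himg, Function.Injective.encard_image]
  intro k l h
  simpa [Fin.ext_iff] using h

end Switch

/-! ### The full twist -/

theorem length_toricBraid (p q : ℕ) : (toricBraid p q).length = q * (p - 1) := by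
  simp [toricBraid]

theorem getElem_toricBraid {p q i m : ℕ} (hi : i < q) (hm : m < p - 1)
    (h : i * (p - 1) + m < (toricBraid p q).length) :
    (toricBraid p q)[i * (p - 1) + m] = (⟨m, hm⟩, true) := by
  induction q generalizing i with
  | zero => omega
  | succ q ih =>
    have hcons : toricBraid p (q + 1) =
        (List.ofFn fun i : Fin (p - 1) => (i, true)) ++ toricBraid p q := by
      simp [toricBraid, List.replicate_succ]
    simp only [hcons]
    cases i with
    | zero =>
      rw [List.getElem_append_left (by simpa using hm)]
      simp
    | succ i =>
      have e : (i + 1) * (p - 1) + m - (p - 1) = i * (p - 1) + m := by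
        rw [Nat.succ_mul]; omega
      rw [List.getElem_append_right (by simp [Nat.succ_mul]; omega)]
      simp only [List.length_ofFn, e]
      exact ih (by omega) _

/-- The position in `B(p, p)` of the strand that starts in position `x`, after `q` factors
`σ₁ ⋯ σ_{p-1}` and `m` letters of the next factor.  The strand number `q` is the one that moves up
during the factor number `q` (from `0`), and it has just passed the positions below `m`. -/
def toricPos (p q m x : ℕ) : ℕ :=
  let y := if q ≤ x then x - q else x + p - q
  if y = 0 then m else if y ≤ m then y - 1 else y

theorem val_swap_lowPos_highPos {n : ℕ} (i : Fin (n - 1)) (a : Fin n) :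
    (Equiv.swap (lowPos i) (highPos i) a : ℕ) =
      if (a : ℕ) = i then (i : ℕ) + 1 else if (a : ℕ) = i + 1 then (i : ℕ) else a := by
  rw [Equiv.swap_apply_def]
  simp only [Fin.ext_iff, lowPos, highPos]
  split_ifs <;> rfl

theorem strandPos_toricBraid {p q m : ℕ} (x : Fin p) (hq : q < p) (hm : m ≤ p - 1) :
    (strandPos (toricBraid p p) x (q * (p - 1) + m) : ℕ) = toricPos p q m x := by
  have hx := x.isLt
  have step : ∀ q < p, (strandPos (toricBraid p p) x (q * (p - 1)) : ℕ) = toricPos p q 0 x →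
      ∀ m ≤ p - 1, (strandPos (toricBraid p p) x (q * (p - 1) + m) : ℕ) = toricPos p q m x := by
    intro q hq h0 m hm
    induction m with
    | zero => exact h0
    | succ m ih =>
      have hlt : q * (p - 1) + m < (toricBraid p p).length := by
        rw [length_toricBraid]
        calc q * (p - 1) + m < q * (p - 1) + (p - 1) := by omega
          _ = (q + 1) * (p - 1) := (Nat.succ_mul _ _).symm
          _ ≤ p * (p - 1) := Nat.mul_le_mul_right _ hq
      have hs := strandPos_succ (toricBraid p p) x ⟨_, hlt⟩
      simp only [List.get_eq_getElem, getElem_toricBraid hq (show m < p - 1 by omega) hlt] at hs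
      have ih' := ih (by omega)
      rw [← add_assoc, hs, val_swap_lowPos_highPos, ih']
      simp only [toricPos]
      split_ifs <;> omega
  have base : ∀ q < p, (strandPos (toricBraid p p) x (q * (p - 1)) : ℕ) = toricPos p q 0 x := by
    intro q hq
    induction q with
    | zero =>
      simp only [zero_mul, strandPos_zero, toricPos]
      split_ifs <;> omega
    | succ q ih =>
      rw [Nat.succ_mul, step q (by omega) (ih (by omega)) (p - 1) le_rfl]
      simp only [toricPos]
      split_ifs <;> omega
  exact step q hq (base q hq) m hm

theorem braidPerm_toricBraid (p : ℕ) : braidPerm (toricBraid p p) = 1 := by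
  ext x
  have hx := x.isLt
  have hlen : (toricBraid p p).length = (p - 1) * (p - 1) + (p - 1) := by
    rw [length_toricBraid, ← Nat.succ_mul]
    congr 1
    omega
  rw [← strandPos_length, hlen, strandPos_toricBraid x (by omega) le_rfl]
  simp only [toricPos, Equiv.Perm.one_apply]
  split_ifs <;> omega

theorem exists_factor {p k : ℕ} (hk : k < p * (p - 1)) :
    ∃ q m, q < p ∧ m < p - 1 ∧ k = q * (p - 1) + m := by
  have hp : 0 < p - 1 := Nat.pos_of_ne_zero fun h => by simp [h] at hk
  refine ⟨k / (p - 1), k % (p - 1), Nat.div_lt_of_lt_mul (by rwa [mul_comm]), Nat.mod_lt _ hp, ?_⟩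
  rw [mul_comm]
  exact (Nat.div_add_mod _ _).symm

theorem factor_lt {p q m : ℕ} (hq : q < p) (hm : m < p - 1) :
    q * (p - 1) + m < (toricBraid p p).length := by
  rw [length_toricBraid]
  calc q * (p - 1) + m < q * (p - 1) + (p - 1) := by omega
    _ = (q + 1) * (p - 1) := (Nat.succ_mul _ _).symm
    _ ≤ p * (p - 1) := Nat.mul_le_mul_right _ hq

/-- The crossing number `m` of the factor number `q` is the one where the strand `q` passes the
strand `q + m + 1` (modulo `p`). -/
theorem crossAt_toricBraid {p q m : ℕ} (hq : q < p) (hm : m < p - 1) (x y : Fin p) :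
    CrossAt (toricBraid p p) ⟨q * (p - 1) + m, factor_lt hq hm⟩ x y ↔
      (x : ℕ) = q ∧ ((y : ℕ) = q + m + 1 ∨ (y : ℕ) + p = q + m + 1) := by
  have hx := x.isLt
  have hy := y.isLt
  simp only [CrossAt, List.get_eq_getElem, getElem_toricBraid hq hm, lowPos, highPos, Fin.ext_iff,
    strandPos_toricBraid _ hq hm.le, toricPos]
  constructor
  · intro h
    split_ifs at h <;> omega
  · intro h
    split_ifs <;> omega

theorem add_one_mem_UCrossingData {p q m : ℕ} (hq : q < p) (hm : m < p - 1) :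
    q * (p - 1) + m + 1 ∈ UCrossingData p p ↔ p ≤ q + m + 1 := by
  simp only [UCrossingData, Finset.mem_biUnion, Finset.mem_Icc, Finset.mem_image, Finset.mem_range]
  constructor
  · rintro ⟨k, ⟨hk1, hkp⟩, j, hj, h⟩
    have hkq : k = q + 1 := by
      rcases lt_trichotomy k (q + 1) with h1 | h1 | h1
      · have := Nat.mul_le_mul_right (p - 1) (Nat.le_of_lt_succ h1)
        omega
      · exact h1
      · have := Nat.mul_le_mul_right (p - 1) (show q + 2 ≤ k from h1)
        rw [Nat.add_mul] at this
        omega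
    subst hkq
    rw [Nat.succ_mul] at h
    omega
  · intro h
    refine ⟨q + 1, ⟨by omega, hq⟩, p - 2 - m, by omega, ?_⟩
    rw [Nat.succ_mul]
    omega

theorem UCrossingData_subset (p : ℕ) :
    UCrossingData p p ⊆ Finset.Icc 1 (toricBraid p p).length := by
  intro N hN
  simp only [UCrossingData, Finset.mem_biUnion, Finset.mem_Icc, Finset.mem_image,
    Finset.mem_range] at hN
  obtain ⟨k, ⟨hk1, hkp⟩, j, hj, rfl⟩ := hN
  rw [length_toricBraid, Finset.mem_Icc]
  have h1 := Nat.mul_le_mul_right (p - 1) hkp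
  have h2 := Nat.mul_le_mul_right (p - 1) (show 1 ≤ k from hk1)
  omega

theorem card_UCrossingData (p : ℕ) : (UCrossingData p p).card = p * (p - 1) / 2 := by
  rw [UCrossingData, Finset.card_biUnion]
  · have hcard : ∀ k ∈ Finset.Icc 1 p,
        ((Finset.range (k - 1)).image fun j => k * (p - 1) - j).card = k - 1 := by
      intro k hk
      rw [Finset.card_image_of_injOn, Finset.card_range]
      intro i hi j hj hij
      have h1 := Finset.mem_Icc.1 hk
      have h2 := Nat.mul_le_mul_right (p - 1) h1.1
      simp only [Finset.coe_range, Set.mem_Iio] at hi hj hij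
      omega
    rw [Finset.sum_congr rfl hcard, ← Finset.sum_range_id, Finset.range_eq_Ico,
      Finset.sum_Ico_eq_sum_range, Finset.range_eq_Ico]
    rw [show Finset.Icc 1 p = Finset.Ico 1 (p + 1) from rfl, Finset.sum_Ico_eq_sum_range]
    simp
  · intro k hk l hl hkl
    wlog hlt : k < l generalizing k l
    · exact (this hl hk hkl.symm (by omega)).symm
    have h1 := Finset.mem_Icc.1 hk
    have h2 := Finset.mem_Icc.1 hl
    rw [Function.onFun, Finset.disjoint_left]
    intro N hN hN'
    simp only [Finset.mem_image, Finset.mem_range] at hN hN'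
    obtain ⟨i, hi, rfl⟩ := hN
    obtain ⟨j, hj, h⟩ := hN'
    have h3 := Nat.mul_le_mul_right (p - 1) (show k + 1 ≤ l from hlt)
    rw [Nat.succ_mul] at h3
    omega

/-- After the switch, the strand that starts in the lower position is on top at every crossing. -/
theorem switchAt_toricBraid_layered (p : ℕ)
    (k : Fin (switchAt (toricBraid p p) (UCrossingData p p)).length) (x y : Fin p)
    (h : CrossAt (switchAt (toricBraid p p) (UCrossingData p p)) k x y) :
    ((switchAt (toricBraid p p) (UCrossingData p p)).get k).2 = true ↔ x < y := by
  rw [crossAt_switchAt] at h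
  rw [get_switchAt]
  have hlen := length_switchAt (toricBraid p p) (UCrossingData p p)
  obtain ⟨k, hk⟩ := k
  obtain ⟨q, m, hq, hm, rfl⟩ := exists_factor (p := p) (k := k) (by
    rwa [hlen, length_toricBraid] at hk)
  have h' := (crossAt_toricBraid hq hm x y).1 h
  have hx := x.isLt
  have hy := y.isLt
  simp only [add_one_mem_UCrossingData hq hm, Fin.cast_mk, List.get_eq_getElem,
    getElem_toricBraid hq hm, Fin.lt_def]
  split_ifs with hU
  · simp only [Bool.not_true, Bool.false_eq_true, false_iff]
    omega
  · simp only [true_iff]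
    omega

theorem linkingAngle_toricBraid_ne_zero {p : ℕ} {x y : Fin p} (hxy : x < y) :
    linkingAngle (strandCurve (toricBraid p p) x) (strandCurve (toricBraid p p) y) ≠ 0 := by
  have hx := x.isLt
  have hy := y.isLt
  have hlt : (x : ℕ) < y := hxy
  have hma : (y : ℕ) - x - 1 < p - 1 := by omega
  have hmb : (x : ℕ) + p - y - 1 < p - 1 := by omega
  have hmul := Nat.mul_le_mul_right (p - 1) (show (x : ℕ) + 1 ≤ y from hlt)
  rw [Nat.succ_mul] at hmul
  -- The sign of the difference of the positions, in the factor `q` after `m` letters.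
  have pos : ∀ q m, q < p → m ≤ p - 1 →
      (strandPos (toricBraid p p) x (q * (p - 1) + m) <
        strandPos (toricBraid p p) y (q * (p - 1) + m) ↔
      (q < x ∨ q = x ∧ m ≤ y - x - 1) ∨ (y : ℕ) < q ∨ q = y ∧ x + p - y - 1 < m) := by
    intro q m hq hm
    rw [Fin.lt_def, strandPos_toricBraid x hq hm, strandPos_toricBraid y hq hm]
    simp only [toricPos]
    split_ifs <;> omega
  have ne : ∀ k, strandPos (toricBraid p p) x k ≠ strandPos (toricBraid p p) y k := fun k h =>
    hxy.ne (strandPos_injective _ k h)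
  have factor : ∀ k ≤ p * (p - 1), ∃ q m, q < p ∧ m ≤ p - 1 ∧ k = q * (p - 1) + m := by
    intro k hk
    rcases hk.lt_or_eq with h | rfl
    · obtain ⟨q, m, hq, hm, rfl⟩ := exists_factor h
      exact ⟨q, m, hq, hm.le, rfl⟩
    · refine ⟨p - 1, p - 1, by omega, le_rfl, ?_⟩
      rw [← Nat.succ_mul]
      congr 1
      omega
  have la := factor_lt hx hma
  have lb := factor_lt hy hmb
  have hlen := length_toricBraid p p
  have up : ∀ {q r : ℕ}, q < r → q * (p - 1) + (p - 1) ≤ r * (p - 1) := by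
    intro q r h
    rw [← Nat.succ_mul]
    exact Nat.mul_le_mul_right _ h
  refine linkingAngle_strandCurve_ne_zero (braidPerm_toricBraid p)
    (a := ⟨x * (p - 1) + (y - x - 1), la⟩) (b := ⟨y * (p - 1) + (x + p - y - 1), lb⟩) ?_
    ((crossAt_toricBraid hx hma x y).2 ?_) ((crossAt_toricBraid hy hmb y x).2 ?_) ?_ ?_ ?_ ?_ ?_
  · simp only [Fin.lt_def]
    omega
  · omega
  · omega
  · simp only [List.get_eq_getElem, getElem_toricBraid hx hma]
  · simp only [List.get_eq_getElem, getElem_toricBraid hy hmb]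
  · intro k hk
    simp only at hk
    obtain ⟨q, m, hq, hm, rfl⟩ := factor k (by omega)
    rw [pos q m hq hm]
    rcases lt_trichotomy q x with h | rfl | h
    · omega
    · omega
    · have := up h
      omega
  · intro k hk hk'
    simp only at hk hk'
    obtain ⟨q, m, hq, hm, rfl⟩ := factor k (by omega)
    refine lt_of_le_of_ne (not_lt.1 fun h => ?_) (ne _).symm
    rw [pos q m hq hm] at h
    rcases h with (h | ⟨rfl, h⟩) | h | ⟨rfl, h⟩
    · have := up h
      omega
    · omega
    · have := up h
      omega
    · omega
  · intro k hk hk'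
    simp only at hk
    obtain ⟨q, m, hq, hm, rfl⟩ := factor k (by omega)
    rw [pos q m hq hm]
    rcases lt_trichotomy q y with h | rfl | h
    · have := up h
      omega
    · omega
    · omega

theorem isotopic_refl {ι : Type} {L : Curves ι} (hL : IsLink L) : Isotopic L L :=
  ⟨fun _ => L, fun i => (hL.smooth i).comp contDiff_snd, fun _ _ => hL, rfl, rfl⟩

theorem isUnknottingNumber_torusLink (p : ℕ) :
    IsUnknottingNumber (torusLink p p) (p * (p - 1) / 2) := by
  have hw := braidPerm_toricBraid p
  have hw' : braidPerm (switchAt (toricBraid p p) (UCrossingData p p)) = 1 := by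
    rw [braidPerm_congr (map_fst_switchAt _ _), hw]
  have inj : Function.Injective (Quotient.out : Component (toricBraid p p) → Fin p) :=
    Quotient.out_injective
  have bij : Function.Bijective (Quotient.out : Component (toricBraid p p) → Fin p) :=
    ⟨inj, out_surjective hw⟩
  have hlink : torusLink p p = strandCurves (toricBraid p p) Quotient.out :=
    braidClosure_eq_strandCurves hw
  constructor
  · refine ⟨strandCurves (toricBraid p p) Quotient.out,
      strandCurves (switchAt (toricBraid p p) (UCrossingData p p)) Quotient.out, ?_,
      isDiagram_strandCurves hw inj, strandCurves_switchAt_fst _ _, ?_,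
      isUnlink_strandCurves hw' (switchAt_toricBraid_layered p) inj⟩
    · rw [hlink]
      exact isotopic_refl (isLink_strandCurves hw inj)
    · rw [encard_switchedCrossings hw bij (UCrossingData_subset p), card_UCrossingData]
  · intro k hk
    have : Fintype (Component (toricBraid p p)) := Fintype.ofInjective _ inj
    have h := choose_two_le_of_canBeUnlinkedBy (fun i j hij => ?_) hk
    · rwa [Fintype.card_of_bijective bij, Fintype.card_fin, Nat.choose_two_right] at h
    · rw [hlink]
      exact (lt_or_gt_of_ne (inj.ne hij)).imp linkingAngle_toricBraid_ne_zero
        linkingAngle_toricBraid_ne_zero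

end
end TorusLinks

theorem theorem5p1 (p : ℕ) (hp : 1 ≤ p) :
    TorusLinks.IsMinimalUnknottingCrossingData
        (TorusLinks.toricBraid p p) (TorusLinks.UCrossingData p p) ∧
      (TorusLinks.UCrossingData p p).card = p * (p - 1) / 2 ∧
      TorusLinks.IsUnknottingNumber (TorusLinks.torusLink p p) (p * (p - 1) / 2) := by
  have hcard := TorusLinks.card_UCrossingData p
  have hU := TorusLinks.isUnknottingNumber_torusLink p
  have hw : TorusLinks.braidPerm
      (TorusLinks.switchAt (TorusLinks.toricBraid p p) (TorusLinks.UCrossingData p p)) = 1 := by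
    rw [TorusLinks.braidPerm_congr (TorusLinks.map_fst_switchAt _ _),
      TorusLinks.braidPerm_toricBraid]
  refine ⟨⟨⟨TorusLinks.UCrossingData_subset p, ?_⟩, ?_⟩, hcard, hU⟩
  · rw [TorusLinks.braidClosure_eq_strandCurves hw]
    exact TorusLinks.isUnlink_strandCurves hw (TorusLinks.switchAt_toricBraid_layered p)
      Quotient.out_injective
  · rw [hcard]
    exact hU
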